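/- Let $A\in\mathbb R^{m\times m}$ be symmetric positive definite and $Z=[\bm z_1^{(0)},\dots,\bm z_n^{(0)}]\in\mathbb R^{m\times n}$. MGS-HA computes, for $j=1,\dots,n$: $$r_{ij}=\bm p_i^{\rm T}\bm z_j^{(i-1)},\quad \bm z_j^{(i)}=\bm z_j^{(i-1)}-r_{ij}\bm q_i\quad(i=1,\dots,j-1),$$ $$\bm x_j=A\bm z_j^{(j-1)},\quad r_{jj}=\sqrt{(\bm z_j^{(j-1)})^{\rm T}\bm x_j},\quad \bm q_j=\bm z_j^{(j-1)}/r_{jj},\quad \bm p_j=\bm x_j/r_{jj}.$$ Suppose that it is run without breakdown (the computed number under each square root is positive) in floating-point arithmetic with unit roundoff ${\bf u}\ge 0$: every elementary operation ($+,-,\times,/,\sqrt{\ }$) returns the exact result times $1+\delta$ for some $|\delta|\le{\bf u}$; all inner products are summed in one fixed arbitrary order (any binary summation tree), and so are all rows of the matrix-vector products. Hats denote computed quantities, $\widehat Q=[\widehat{\bm q}_1,\dots,\widehat{\bm q}_n]$, $\gamma_k:=k{\bf u}/(1-k{\bf u})$, $\|\cdot\|$ is the 2-norm, $\|\bm x\|_A:=\sqrt{\bm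 x^{\rm T}A\bm x}$, and $\kappa$ is the ratio of the largest to the smallest singular value. (i) If $(m\sqrt m+m+2){\bf u}<1$, then for all $i<j$ $$|\widehat r_{ij}-\widehat{\bm q}_i^{\rm T}A\widehat{\bm z}_j^{(i-1)}|\le\gamma_{m\sqrt m+m+2}\,\|A\|\,\|\widehat{\bm q}_i\|\,\|\widehat{\bm z}_j^{(i-1)}\|.$$ (ii) There are absolute constants $C_1,C_2>0$ (independent of $m,n,A,Z,{\bf u}$, the summation orders and the rounding errors) such that the following holds whenever $1\le n\le m$ and $Z$ has full column rank. Put $$\theta_1:=C_1m^{3/2}{\bf u}\,\|A\|\,\|\widehat Q\|\max_{i\le j}\frac{\|\widehat{\bm z}_j^{(i-1)}\|}{\|\widehat{\bm z}_j^{(i-1)}\|_A}\,\kappa(A^{1/2}Z),\qquad \theta_2:=C_2m^{3/2}{\bf u}\,\kappa(A)\,\kappa(A^{1/2}Z).$$ If $\theta_2<1$, then $\theta_1<1$ and $$\|\widehat Q^{\rm T}A\widehat Q-I_n\|\le\frac{\theta_1}{1-\theta_1}\le\frac{\theta_2}{1-\theta_2}.$$ -/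

import Mathlib

open scoped Matrix Matrix.Norms.L2Operator MatrixOrder

noncomputable section

namespace MGSHA

/-- The constant `γ_k = k u / (1 - k u)`, for a real index `k`. -/
def gam (u k : ℝ) : ℝ := k * u / (1 - k * u)

/-- The Euclidean norm of a vector. -/
def vnorm {m : ℕ} (x : Fin m → ℝ) : ℝ := ‖WithLp.toLp 2 x‖

/-- The `A`-norm `√(xᵀ A x)` of a vector. -/
def anorm {m : ℕ} (A : Matrix (Fin m) (Fin m) ℝ) (x : Fin m → ℝ) : ℝ := √(x ⬝ᵥ A *ᵥ x)

/-- The condition number `σ₁ / σₙ` of a matrix with `n` columns (of full column rank), the quotient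
of its largest and its smallest singular value. Mathlib indexes singular values from `0`, in
decreasing order. -/
def cond {m n : ℕ} (B : Matrix (Fin m) (Fin n) ℝ) : ℝ :=
  (Matrix.toEuclideanLin B).singularValues 0 / (Matrix.toEuclideanLin B).singularValues (n - 1)

/-! ### Floating-point arithmetic with unit roundoff `u`

The standard model: every elementary operation returns the exact result times `1 + δ` with
`|δ| ≤ u`. Each predicate says that `y` is a possible computed value. -/

/-- `y` is a possible computed value of an elementary operation with exact result `x`. -/
def FlRound (u x y : ℝ) : Prop := ∃ δ : ℝ, |δ| ≤ u ∧ y = x * (1 + δ)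

/-- An order of summation: a binary tree whose leaves are the indices of the summands. -/
inductive SumTree (m : ℕ) : Type
  | leaf (k : Fin m) : SumTree m
  | node (l r : SumTree m) : SumTree m

/-- The indices at the leaves, with multiplicity. -/
def SumTree.leaves {m : ℕ} : SumTree m → Multiset (Fin m)
  | .leaf k => {k}
  | .node l r => l.leaves + r.leaves

/-- Every index occurs at exactly one leaf. -/
def SumTree.Complete {m : ℕ} (τ : SumTree m) : Prop :=
  τ.leaves = (Finset.univ : Finset (Fin m)).val

/-- `FlSum u t τ y`: adding the numbers `t k` in the order `τ`, each addition being rounded,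
may return `y`. -/
inductive FlSum (u : ℝ) {m : ℕ} (t : Fin m → ℝ) : SumTree m → ℝ → Prop
  | leaf (k : Fin m) : FlSum u t (.leaf k) (t k)
  | node {l r : SumTree m} {a b y : ℝ} (ha : FlSum u t l a) (hb : FlSum u t r b)
      (hy : FlRound u (a + b) y) : FlSum u t (.node l r) y

/-- `y` is a possible computed value of the inner product `xᵀ w`, summed in the order `τ`. -/
def FlDot (u : ℝ) {m : ℕ} (τ : SumTree m) (x w : Fin m → ℝ) (y : ℝ) : Prop :=
  ∃ t : Fin m → ℝ, (∀ k, FlRound u (x k * w k) (t k)) ∧ FlSum u t τ y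

/-- `y` is a possible computed value of the matrix-vector product `A x`, each entry being the
inner product of a row of `A` with `x`, summed in the order `σ`. -/
def FlMulVec (u : ℝ) {m : ℕ} (σ : SumTree m) (A : Matrix (Fin m) (Fin m) ℝ)
    (x y : Fin m → ℝ) : Prop :=
  ∀ k, FlDot u σ (A k) x (y k)

/-- `y` is a possible computed value of the vector `z - r q`. -/
def FlAxpy (u : ℝ) {m : ℕ} (z : Fin m → ℝ) (r : ℝ) (q y : Fin m → ℝ) : Prop :=
  ∀ k, ∃ t : ℝ, FlRound u (r * q k) t ∧ FlRound u (z k - t) (y k)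

/-- `y` is a possible computed value of the vector `x / r`. -/
def FlScale (u : ℝ) {m : ℕ} (x : Fin m → ℝ) (r : ℝ) (y : Fin m → ℝ) : Prop :=
  ∀ k, FlRound u (x k / r) (y k)

/-- The quantities that MGS-HA computes for an `m × n` input. Columns are indexed from `0`;
`z j i` is the vector obtained from the `j`-th input column after `i` orthogonalization steps, so
the vector that enters the computation of the entry `r i j` is `z j i`. -/
structure Computed (m n : ℕ) where
  z : Fin n → ℕ → Fin m → ℝ
  x : Fin n → Fin m → ℝ
  s : Fin n → ℝ
  r : Fin n → Fin n → ℝ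
  q : Fin n → Fin m → ℝ
  p : Fin n → Fin m → ℝ

/-- The computed factor `Q`, with columns `q j`. -/
def Computed.Q {m n : ℕ} (c : Computed m n) : Matrix (Fin m) (Fin n) ℝ :=
  Matrix.of fun k j => c.q j k

/-- `c` is the record of a run of MGS-HA on `A` and `Z` in floating-point arithmetic with unit
roundoff `u`, without breakdown (the number `s j` under the square root is positive).
Inner products are summed in the order `τ`, matrix-vector products in the order `σ`. -/
structure IsRun {m n : ℕ} (u : ℝ) (τ σ : SumTree m) (A : Matrix (Fin m) (Fin m) ℝ)
    (Z : Matrix (Fin m) (Fin n) ℝ) (c : Computed m n) : Prop where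
  /-- The process starts from the columns of `Z`. -/
  init : ∀ j k, c.z j 0 k = Z k j
  /-- `r_ij = p_iᵀ z_j` for `i < j`. -/
  offdiag : ∀ i j, i < j → FlDot u τ (c.p i) (c.z j i) (c.r i j)
  /-- `z_j ← z_j - r_ij q_i` for `i < j`. -/
  update : ∀ i j : Fin n, i < j → FlAxpy u (c.z j i) (c.r i j) (c.q i) (c.z j (i + 1))
  /-- `x_j = A z_j`. -/
  mulVec : ∀ j : Fin n, FlMulVec u σ A (c.z j j) (c.x j)
  /-- `s_j = z_jᵀ x_j`. -/
  radicand : ∀ j : Fin n, FlDot u τ (c.z j j) (c.x j) (c.s j)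
  /-- No breakdown. -/
  radicand_pos : ∀ j, 0 < c.s j
  /-- `r_jj = √s_j`. -/
  diag : ∀ j, FlRound u √(c.s j) (c.r j j)
  /-- `q_j = z_j / r_jj`. -/
  scale_q : ∀ j : Fin n, FlScale u (c.z j j) (c.r j j) (c.q j)
  /-- `p_j = x_j / r_jj`. -/
  scale_p : ∀ j : Fin n, FlScale u (c.x j) (c.r j j) (c.p j)

/-- `max_{i ≤ j} ‖z_j^{(i-1)}‖ / ‖z_j^{(i-1)}‖_A` over the computed vectors. -/
def Computed.maxRatio {m n : ℕ} (A : Matrix (Fin m) (Fin m) ℝ) (c : Computed m n) : ℝ :=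
  ⨆ e : {e : Fin n × Fin n // e.1 ≤ e.2},
    vnorm (c.z e.1.2 e.1.1) / anorm A (c.z e.1.2 e.1.1)

end MGSHA

end

namespace MGSHA

/-! ### Euclidean norms of vectors and operator norms of matrices -/

/-! Everything rests on one estimate for matrix-vector products (`vnorm_flDot_sub_le`). If all rows
of $B$ are summed along the same tree, the vector formed by the exact partial sums over an index set
$S$ is $B$ applied to a truncation of $x$, up to the rounding of the products, so its norm is at
most $(1+\sqrt m\,u)\|B\|\|x\|$. Each of the $m-1$ additions then perturbs the whole vector
relatively, and the total error is about $(m+\sqrt m)u\|B\|\|x\|$, without the factor $\sqrt m$ lost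
in passing to the entrywise absolute value of $B$. Part (i) composes two such errors ($Az$ and
$p^Tz$) with the two divisions by the same computed $r_{jj}$, whose own error cancels in $p-Aq$.

For part (ii) put $H=A^{1/2}$ and let $S_i$ be the matrix after $i$ steps, with the finished columns
set to zero. A run satisfies $S_{i+1}=S_i-q_iR_i+F_i$, $S_n=0$ and $R_i=q_i^TAS_i+E_i$, where $R_i$,
$E_i$ are rows. Telescoping gives $S_i=\sum_{k\ge i}(q_kR_k-F_k)$. Inserting this in the formula for
$R_i$ yields, for the strictly upper part $U$ of $Q^TAQ$, an identity $UR=DR+\sum_k(\text{rows }i\le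
k\text{ of }Q^TAF_k)-E$ with $D=\mathrm{diag}(1-q_i^TAq_i)$ (`strictUpper_mul_eq`). The right side
consists of local errors. The left side controls $U$ as soon as $R$ is bounded below, and
$Q^TAQ-I=U+U^T-D$.

Two bounds on $R$ are needed, and neither may presuppose orthogonality. The upper bound
$\|R\|\le2\|HZ\|$ is an energy argument: subtracting $rw$ with $r\approx w^Tv$ and $\|w\|\approx1$
lowers $\|v\|^2$ by at least $r^2/2$, up to the square of the error in $r$
(`vnorm_sub_smul_sq_add_le`, `norm_coef_le`). The lower bound comes from $HZ=HQR-H\sum_kF_k$, whose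
last term is at most half the smallest singular value of $HZ$. It still contains $\|HQ\|$, which is
removed by a bootstrap: the resulting estimate has the form
$\|HQ\|^2\le1+\varepsilon+\varepsilon'\|HQ\|^2$, hence $\|HQ\|\le3/2$.

The power $m^{3/2}$ arises as follows. A row of coefficient errors is the error of one matrix-vector
product, of size $mu$, and $n$ rows cost $\sqrt n$. An update error is of size $u$ per column, so
$\sqrt n\,u$ per step and $n\sqrt n\,u$ in total. -/

theorem vnorm_nonneg {m : ℕ} (x : Fin m → ℝ) : 0 ≤ vnorm x := norm_nonneg _

theorem vnorm_sq {m : ℕ} (x : Fin m → ℝ) : vnorm x ^ 2 = x ⬝ᵥ x := by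
  rw [vnorm, EuclideanSpace.norm_sq_eq]
  simp [dotProduct, pow_two]

theorem vnorm_zero {m : ℕ} : vnorm (0 : Fin m → ℝ) = 0 := by simp [vnorm]

theorem vnorm_add_le {m : ℕ} (x y : Fin m → ℝ) : vnorm (x + y) ≤ vnorm x + vnorm y := by
  simpa [vnorm] using norm_add_le (WithLp.toLp 2 x) (WithLp.toLp 2 y)

theorem vnorm_sub_le {m : ℕ} (x y : Fin m → ℝ) : vnorm (x - y) ≤ vnorm x + vnorm y := by
  simpa [vnorm] using norm_sub_le (WithLp.toLp 2 x) (WithLp.toLp 2 y)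

theorem vnorm_smul {m : ℕ} (a : ℝ) (x : Fin m → ℝ) : vnorm (a • x) = |a| * vnorm x := by
  simp [vnorm, norm_smul]

theorem vnorm_sum_le {m : ℕ} {ι : Type*} (s : Finset ι) (f : ι → Fin m → ℝ) :
    vnorm (∑ k ∈ s, f k) ≤ ∑ k ∈ s, vnorm (f k) := by
  simpa [vnorm, WithLp.toLp_sum] using norm_sum_le s fun k => WithLp.toLp 2 (f k)

theorem vnorm_eq_zero {m : ℕ} {x : Fin m → ℝ} : vnorm x = 0 ↔ x = 0 := by
  simp [vnorm]

theorem abs_dotProduct_le {m : ℕ} (x y : Fin m → ℝ) : |x ⬝ᵥ y| ≤ vnorm x * vnorm y := by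
  have h := abs_real_inner_le_norm (WithLp.toLp 2 x) (WithLp.toLp 2 y)
  simpa [vnorm, EuclideanSpace.inner_toLp_toLp, dotProduct_comm] using h

theorem vnorm_mono {m : ℕ} {x y : Fin m → ℝ} (h : ∀ k, |x k| ≤ |y k|) : vnorm x ≤ vnorm y := by
  refine le_of_sq_le_sq ?_ (vnorm_nonneg y)
  rw [vnorm_sq, vnorm_sq]
  refine Finset.sum_le_sum fun k _ => ?_
  have := h k
  rw [← pow_two, ← pow_two]
  exact sq_le_sq.mpr this

theorem vnorm_le_mul {m : ℕ} {x y : Fin m → ℝ} {c : ℝ} (hc : 0 ≤ c)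
    (h : ∀ k, |x k| ≤ c * |y k|) : vnorm x ≤ c * vnorm y := by
  have := vnorm_smul c y
  rw [abs_of_nonneg hc] at this
  rw [← this]
  refine vnorm_mono fun k => (h k).trans ?_
  simp [abs_mul, abs_of_nonneg hc]

theorem abs_le_vnorm {m : ℕ} (x : Fin m → ℝ) (k : Fin m) : |x k| ≤ vnorm x := by
  simpa [vnorm] using PiLp.norm_apply_le (WithLp.toLp 2 x) k

theorem sum_abs_le {m : ℕ} (x : Fin m → ℝ) : ∑ k, |x k| ≤ √(m : ℝ) * vnorm x := by
  have h := abs_dotProduct_le (fun k => |x k|) (fun _ => 1)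
  have h1 : vnorm (fun _ : Fin m => (1 : ℝ)) = √(m : ℝ) := by
    simp [vnorm, EuclideanSpace.norm_eq]
  have h2 : vnorm (fun k => |x k|) ≤ vnorm x := vnorm_mono fun k => by simp
  rw [h1] at h
  have h3 : ∑ k, |x k| = (fun k => |x k|) ⬝ᵥ (fun _ => 1) := by simp [dotProduct]
  rw [h3]
  calc _ ≤ _ := le_abs_self _
    _ ≤ _ := h
    _ ≤ vnorm x * √m := by gcongr
    _ = _ := mul_comm _ _

theorem vnorm_le_sqrt_mul {m : ℕ} {x : Fin m → ℝ} {b : ℝ} (hb : 0 ≤ b) (h : ∀ k, |x k| ≤ b) :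
    vnorm x ≤ √(m : ℝ) * b := by
  have h1 : vnorm (fun _ : Fin m => (1 : ℝ)) = √(m : ℝ) := by
    simp [vnorm, EuclideanSpace.norm_eq]
  rw [← h1, mul_comm]
  exact vnorm_le_mul hb fun k => by simpa using h k

theorem vnorm_mulVec_le {m n : ℕ} (B : Matrix (Fin m) (Fin n) ℝ) (x : Fin n → ℝ) :
    vnorm (B *ᵥ x) ≤ ‖B‖ * vnorm x :=
  Matrix.l2_opNorm_mulVec B (WithLp.toLp 2 x)

theorem norm_le_of_vnorm_mulVec_le {m n : ℕ} {B : Matrix (Fin m) (Fin n) ℝ} {b : ℝ} (hb : 0 ≤ b)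
    (h : ∀ x, vnorm (B *ᵥ x) ≤ b * vnorm x) : ‖B‖ ≤ b := by
  rw [Matrix.l2_opNorm_def]
  refine ContinuousLinearMap.opNorm_le_bound _ hb fun x => ?_
  exact h x.ofLp

theorem norm_transpose {m n : ℕ} (B : Matrix (Fin m) (Fin n) ℝ) : ‖Bᵀ‖ = ‖B‖ := by
  simpa using Matrix.l2_opNorm_conjTranspose B

theorem norm_transpose_mul_self {m n : ℕ} (B : Matrix (Fin m) (Fin n) ℝ) :
    ‖Bᵀ * B‖ = ‖B‖ ^ 2 := by
  simpa [pow_two] using Matrix.l2_opNorm_conjTranspose_mul_self B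

theorem vnorm_single {n : ℕ} (j : Fin n) (a : ℝ) : vnorm (Pi.single j a) = |a| := by
  simp [vnorm]

theorem vnorm_col_le {m n : ℕ} (B : Matrix (Fin m) (Fin n) ℝ) (j : Fin n) :
    vnorm (B.col j) ≤ ‖B‖ := by
  have := vnorm_mulVec_le B (Pi.single j 1)
  simpa [vnorm_single] using this

theorem norm_le_of_row_le {m n : ℕ} {B : Matrix (Fin m) (Fin n) ℝ} {b : ℝ} (hb : 0 ≤ b)
    (h : ∀ i, vnorm (B i) ≤ b) : ‖B‖ ≤ √(m : ℝ) * b := by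
  refine norm_le_of_vnorm_mulVec_le (by positivity) fun x => ?_
  rw [mul_assoc]
  have := vnorm_nonneg x
  refine vnorm_le_sqrt_mul (by positivity) fun i => ?_
  refine (abs_dotProduct_le _ _).trans ?_
  gcongr
  exact h i

theorem norm_le_of_col_le {m n : ℕ} {B : Matrix (Fin m) (Fin n) ℝ} {b : ℝ} (hb : 0 ≤ b)
    (h : ∀ j, vnorm (B.col j) ≤ b) : ‖B‖ ≤ √(n : ℝ) * b := by
  rw [← norm_transpose]
  exact norm_le_of_row_le hb h

theorem norm_diagonal_le {n : ℕ} {d : Fin n → ℝ} {b : ℝ} (hb : 0 ≤ b) (h : ∀ i, |d i| ≤ b) :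
    ‖Matrix.diagonal d‖ ≤ b := by
  rw [Matrix.l2_opNorm_diagonal]
  exact (pi_norm_le_iff_of_nonneg hb).mpr h

/-- Setting entries of the argument to zero does not increase its norm. -/
theorem vnorm_mask_le {n : ℕ} (p : Fin n → Prop) [DecidablePred p] (x : Fin n → ℝ) :
    vnorm (fun k => if p k then x k else 0) ≤ vnorm x :=
  vnorm_mono fun k => by split_ifs <;> simp

theorem norm_mask_cols_le {m n : ℕ} (p : Fin n → Prop) [DecidablePred p]
    (B : Matrix (Fin m) (Fin n) ℝ) :
    ‖(Matrix.of fun k j => if p j then B k j else 0 : Matrix (Fin m) (Fin n) ℝ)‖ ≤ ‖B‖ := by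
  refine norm_le_of_vnorm_mulVec_le (norm_nonneg _) fun x => ?_
  have : (Matrix.of fun k j => if p j then B k j else 0 : Matrix (Fin m) (Fin n) ℝ) *ᵥ x
      = B *ᵥ (fun j => if p j then x j else 0) := by
    ext k; simp [Matrix.mulVec, dotProduct]
  rw [this]
  refine (vnorm_mulVec_le _ _).trans ?_
  gcongr
  exact vnorm_mask_le p x

theorem norm_mask_rows_le {m n : ℕ} (p : Fin m → Prop) [DecidablePred p]
    (B : Matrix (Fin m) (Fin n) ℝ) :
    ‖(Matrix.of fun i j => if p i then B i j else 0 : Matrix (Fin m) (Fin n) ℝ)‖ ≤ ‖B‖ := by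
  rw [← norm_transpose, ← norm_transpose B]
  exact norm_mask_cols_le p Bᵀ

theorem dotProduct_mulVec_transpose {m n : ℕ} (B : Matrix (Fin m) (Fin n) ℝ) (x : Fin m → ℝ)
    (y : Fin n → ℝ) : x ⬝ᵥ B *ᵥ y = (Bᵀ *ᵥ x) ⬝ᵥ y := by
  rw [Matrix.dotProduct_mulVec, Matrix.mulVec_transpose]

/-! ### Rounding errors of sums and inner products -/

theorem FlRound.abs_sub_le {u x y : ℝ} (h : FlRound u x y) : |y - x| ≤ u * |x| := by
  obtain ⟨δ, hδ, rfl⟩ := h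
  have : x * (1 + δ) - x = δ * x := by ring
  rw [this, abs_mul]
  gcongr

theorem SumTree.card_leaves_pos {m : ℕ} (τ : SumTree m) : 0 < τ.leaves.card := by
  induction τ with
  | leaf k => simp [SumTree.leaves]
  | node l r hl hr => simp [SumTree.leaves]; omega

theorem SumTree.Complete.pos {m : ℕ} {τ : SumTree m} (h : τ.Complete) : 0 < m := by
  have := τ.card_leaves_pos
  rw [h] at this
  simpa using this

/-- Simultaneous sums in one order: the vector of the errors is bounded in norm when all the
vectors of exact partial sums are. -/
theorem vnorm_flSum_sub_le {u : ℝ} (hu : 0 ≤ u) {l m : ℕ} (t : Fin l → Fin m → ℝ) {B : ℝ}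
    (hB : 0 ≤ B) (τ : SumTree m) :
    ∀ (y : Fin l → ℝ), (∀ i, FlSum u (t i) τ (y i)) →
      (∀ S ≤ τ.leaves, vnorm (fun i => (S.map (t i)).sum) ≤ B) →
      vnorm (fun i => y i - (τ.leaves.map (t i)).sum) ≤
        ((1 + u) ^ (τ.leaves.card - 1) - 1) * B := by
  induction τ with
  | leaf k =>
    intro y hy _
    have : (fun i => y i - ((SumTree.leaf k).leaves.map (t i)).sum) = 0 := by
      ext i
      have h : ∀ w, FlSum u (t i) (.leaf k) w → w = t i k := by
        intro w hw
        cases hw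
        rfl
      simp [SumTree.leaves, h _ (hy i)]
    rw [this, vnorm_zero]
    simp [SumTree.leaves]
  | node L R ihL ihR =>
    intro y hy hS
    have hex : ∀ i, ∃ a b δ : ℝ, FlSum u (t i) L a ∧ FlSum u (t i) R b ∧ |δ| ≤ u ∧
        y i = (a + b) * (1 + δ) := by
      intro i
      cases hy i with
      | node ha hb hy =>
        obtain ⟨δ, hδ, h⟩ := hy
        exact ⟨_, _, δ, ha, hb, hδ, h⟩
    choose a b δ ha hb hδ hy' using hex
    have h1 := ihL a ha fun S h => hS S (h.trans (Multiset.le_add_right _ _))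
    have h2 := ihR b hb fun S h => hS S (h.trans (Multiset.le_add_left _ _))
    have h3 := hS (L.node R).leaves le_rfl
    have hcard : (L.node R).leaves.card - 1 = (L.leaves.card - 1) + (R.leaves.card - 1) + 1 := by
      have := L.card_leaves_pos
      have := R.card_leaves_pos
      simp only [SumTree.leaves, Multiset.card_add]
      omega
    rw [hcard]
    have hX : (1 : ℝ) ≤ (1 + u) ^ (L.leaves.card - 1) := one_le_pow₀ (by linarith)
    have hY : (1 : ℝ) ≤ (1 + u) ^ (R.leaves.card - 1) := one_le_pow₀ (by linarith)
    rw [pow_succ, pow_add]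
    set X := (1 + u) ^ (L.leaves.card - 1)
    set Y := (1 + u) ^ (R.leaves.card - 1)
    set dL : Fin l → ℝ := fun i => a i - (L.leaves.map (t i)).sum with hdL
    set dR : Fin l → ℝ := fun i => b i - (R.leaves.map (t i)).sum with hdR
    set s : Fin l → ℝ := fun i => ((L.node R).leaves.map (t i)).sum with hs
    have hsplit : (fun i => y i - s i) = (dL + dR) + fun i => δ i * (s i + (dL + dR) i) := by
      ext i
      simp only [Pi.add_apply, hy', hs, hdL, hdR, SumTree.leaves, Multiset.map_add,
        Multiset.sum_add]
      ring
    have hd := vnorm_add_le dL dR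
    have hround : vnorm (fun i => δ i * (s i + (dL + dR) i)) ≤ u * vnorm (s + (dL + dR)) :=
      vnorm_le_mul hu fun i => by
        rw [abs_mul]
        exact mul_le_mul_of_nonneg_right (hδ i) (abs_nonneg _)
    have hsd := vnorm_add_le s (dL + dR)
    calc vnorm (fun i => y i - s i)
        ≤ vnorm (dL + dR) + vnorm (fun i => δ i * (s i + (dL + dR) i)) := by
          rw [hsplit]; exact vnorm_add_le _ _
      _ ≤ ((X - 1) * B + (Y - 1) * B) + u * (B + ((X - 1) * B + (Y - 1) * B)) := by
          refine add_le_add (by linarith) (hround.trans ?_)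
          gcongr
          linarith
      -- The two sides differ by exactly $(1+u)(X-1)(Y-1)B\ge0$.
      _ ≤ (X * Y * (1 + u) - 1) * B := by
          have : 0 ≤ (1 + u) * ((X - 1) * (Y - 1)) * B := by
            have := sub_nonneg.mpr hX
            have := sub_nonneg.mpr hY
            positivity
          linarith

/-- The relative error bound for inner products with `m` summands. -/
noncomputable def accErr (m : ℕ) (u : ℝ) : ℝ := (1 + u) ^ (m - 1) * (1 + √(m : ℝ) * u) - 1

theorem accErr_nonneg {u : ℝ} (hu : 0 ≤ u) (m : ℕ) : 0 ≤ accErr m u := by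
  have h1 : (1 : ℝ) ≤ (1 + u) ^ (m - 1) := one_le_pow₀ (by linarith)
  have h2 : (1 : ℝ) ≤ 1 + √(m : ℝ) * u := by
    have : 0 ≤ √(m : ℝ) * u := by positivity
    linarith
  unfold accErr
  nlinarith

/-- The computed product of a rectangular matrix with a vector. -/
theorem vnorm_flDot_sub_le {u : ℝ} (hu : 0 ≤ u) {l m : ℕ} {τ : SumTree m} (hτ : τ.Complete)
    (B : Matrix (Fin l) (Fin m) ℝ) (x : Fin m → ℝ) (y : Fin l → ℝ)
    (h : ∀ i, FlDot u τ (B i) x (y i)) :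
    vnorm (y - B *ᵥ x) ≤ accErr m u * (‖B‖ * vnorm x) := by
  choose t ht hy using h
  choose δ hδ ht using ht
  have hx := vnorm_nonneg x
  -- the rounding errors of the products
  have herr : ∀ S : Finset (Fin m),
      vnorm (fun i => ∑ k ∈ S, B i k * x k * δ i k) ≤ √(m : ℝ) * u * (‖B‖ * vnorm x) := by
    intro S
    have h1 : (fun i => ∑ k ∈ S, B i k * x k * δ i k)
        = ∑ k ∈ S, fun i => B i k * x k * δ i k := by
      ext i; simp
    rw [h1]
    calc _ ≤ ∑ k ∈ S, vnorm (fun i => B i k * x k * δ i k) := vnorm_sum_le _ _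
      _ ≤ ∑ k ∈ S, u * ‖B‖ * |x k| := by
          refine Finset.sum_le_sum fun k _ => ?_
          have h2 : vnorm (fun i => B i k * x k * δ i k) ≤ (u * |x k|) * vnorm (B.col k) :=
            vnorm_le_mul (by positivity) fun i => by
              rw [abs_mul, abs_mul]
              have := mul_le_mul_of_nonneg_left (hδ i k)
                (mul_nonneg (abs_nonneg (B i k)) (abs_nonneg (x k)))
              simp only [Matrix.col_apply]
              linarith
          have h3 : (u * |x k|) * vnorm (B.col k) ≤ (u * |x k|) * ‖B‖ := by
            gcongr
            exact vnorm_col_le B k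
          linarith
      _ ≤ ∑ k, u * ‖B‖ * |x k| :=
          Finset.sum_le_sum_of_subset_of_nonneg (Finset.subset_univ S)
            fun k _ _ => by positivity
      _ = u * ‖B‖ * ∑ k, |x k| := by rw [Finset.mul_sum]
      _ ≤ u * ‖B‖ * (√(m : ℝ) * vnorm x) := by
          gcongr
          exact sum_abs_le x
      _ = _ := by ring
  have hpart : ∀ S : Finset (Fin m), (fun i => ∑ k ∈ S, t i k) =
      B *ᵥ (fun k => if k ∈ S then x k else 0) + fun i => ∑ k ∈ S, B i k * x k * δ i k := by
    intro S
    ext i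
    simp only [Matrix.mulVec, dotProduct, Pi.add_apply, mul_ite, mul_zero, Finset.sum_ite_mem,
      Finset.univ_inter, ← Finset.sum_add_distrib]
    refine Finset.sum_congr rfl fun k _ => ?_
    rw [ht]; ring
  have hbound : ∀ S : Finset (Fin m), vnorm (fun i => ∑ k ∈ S, t i k) ≤
      (1 + √(m : ℝ) * u) * (‖B‖ * vnorm x) := by
    intro S
    rw [hpart S]
    have h1 := vnorm_add_le (B *ᵥ (fun k => if k ∈ S then x k else 0))
      (fun i => ∑ k ∈ S, B i k * x k * δ i k)
    have h2 : vnorm (B *ᵥ (fun k => if k ∈ S then x k else 0)) ≤ ‖B‖ * vnorm x := by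
      refine (vnorm_mulVec_le _ _).trans ?_
      gcongr
      exact vnorm_mask_le _ x
    linarith [herr S]
  have hsum := vnorm_flSum_sub_le hu t (B := (1 + √(m : ℝ) * u) * (‖B‖ * vnorm x))
    (by positivity) τ y hy (by
      intro S hS
      rw [hτ] at hS
      have hnd : S.Nodup := Multiset.nodup_of_le hS Finset.univ.nodup
      exact hbound ⟨S, hnd⟩)
  have hcard : (Finset.univ : Finset (Fin m)).val.card = m := by simp
  rw [hτ, hcard] at hsum
  have hsum' : vnorm (fun i => y i - ∑ k, t i k) ≤
      ((1 + u) ^ (m - 1) - 1) * ((1 + √(m : ℝ) * u) * (‖B‖ * vnorm x)) := hsum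
  have hdec : y - B *ᵥ x =
      (fun i => y i - ∑ k, t i k) + fun i => ∑ k, B i k * x k * δ i k := by
    ext i
    have := congrFun (hpart Finset.univ) i
    simp only [Pi.add_apply, Finset.mem_univ, if_true] at this
    simp only [Pi.sub_apply, Pi.add_apply]
    linarith
  rw [hdec]
  have := vnorm_add_le (fun i => y i - ∑ k, t i k) (fun i => ∑ k, B i k * x k * δ i k)
  have := herr Finset.univ
  unfold accErr
  linarith

theorem FlDot.comm {u : ℝ} {m : ℕ} {τ : SumTree m} {x w : Fin m → ℝ} {y : ℝ}
    (h : FlDot u τ x w y) : FlDot u τ w x y := by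
  obtain ⟨t, ht, hy⟩ := h
  exact ⟨t, fun k => by rw [mul_comm]; exact ht k, hy⟩

/-- Lets zero rows be added to a family of computed inner products, so that the result is still one
computed matrix-vector product. -/
theorem flDot_zero {u : ℝ} (hu : 0 ≤ u) {m : ℕ} (τ : SumTree m) (w : Fin m → ℝ) :
    FlDot u τ 0 w 0 := by
  refine ⟨0, fun k => ⟨0, by simpa, by simp⟩, ?_⟩
  induction τ with
  | leaf k => exact FlSum.leaf k
  | node l r hl hr => exact FlSum.node hl hr ⟨0, by simpa, by simp⟩

/-- The computed inner product of two vectors. -/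
theorem FlDot.abs_sub_le {u : ℝ} (hu : 0 ≤ u) {m : ℕ} {τ : SumTree m} (hτ : τ.Complete)
    {x w : Fin m → ℝ} {y : ℝ} (h : FlDot u τ x w y) :
    |y - x ⬝ᵥ w| ≤ accErr m u * (vnorm x * vnorm w) := by
  have h1 := vnorm_flDot_sub_le hu hτ (Matrix.of fun _ : Fin 1 => x) w (fun _ => y) fun _ => h
  have h2 : ‖(Matrix.of fun _ : Fin 1 => x : Matrix (Fin 1) (Fin m) ℝ)‖ ≤ √((1 : ℕ) : ℝ) * vnorm x :=
    norm_le_of_row_le (vnorm_nonneg x) fun _ => le_rfl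
  have h3 := abs_le_vnorm ((fun _ => y) - (Matrix.of fun _ : Fin 1 => x) *ᵥ w) 0
  have h4 := accErr_nonneg hu m
  have h5 := vnorm_nonneg w
  refine (h3.trans h1).trans ?_
  gcongr
  simpa using h2

/-! ### The accuracy of the coefficients -/

theorem one_add_accErr_le {u : ℝ} (hu : 0 ≤ u) {m : ℕ} (hm : 0 < m) :
    1 + accErr m u ≤ Real.exp ((m - 1 + √(m : ℝ)) * u) := by
  have h1 : (1 + u) ^ (m - 1) ≤ Real.exp u ^ (m - 1) := by
    gcongr
    linarith [Real.add_one_le_exp u]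
  have h2 : 1 + √(m : ℝ) * u ≤ Real.exp (√(m : ℝ) * u) := by
    linarith [Real.add_one_le_exp (√(m : ℝ) * u)]
  have h3 : Real.exp ((m - 1 + √(m : ℝ)) * u) = Real.exp u ^ (m - 1) * Real.exp (√(m : ℝ) * u) := by
    rw [← Real.exp_nat_mul, ← Real.exp_add, Nat.cast_sub hm]
    congr 1
    push_cast
    ring
  have h4 : 1 + accErr m u = (1 + u) ^ (m - 1) * (1 + √(m : ℝ) * u) := by
    unfold accErr; ring
  rw [h3, h4]
  gcongr

theorem exp_le_inv_one_sub {y : ℝ} (hy : y < 1) : Real.exp y ≤ 1 / (1 - y) := by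
  rw [le_div_iff₀ (by linarith)]
  have h1 := Real.add_one_le_exp (-y)
  have h2 : Real.exp y * Real.exp (-y) = 1 := by rw [← Real.exp_add]; simp
  have h3 := Real.exp_pos y
  nlinarith

theorem accErr_le {u : ℝ} (hu : 0 ≤ u) {m : ℕ} (hm : 0 < m) (h : (m : ℝ) * u ≤ 1 / 6) :
    accErr m u ≤ 3 * (m * u) := by
  have h1 := one_add_accErr_le hu hm
  have hm1 : (1 : ℝ) ≤ m := by exact_mod_cast hm
  have hs : √(m : ℝ) ≤ m := by
    rw [Real.sqrt_le_left (by linarith)]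
    nlinarith
  -- With $x=mu$, the bound $1/(1-2x)\le1+3x$ holds exactly for $0\le x\le1/6$.
  have h2 : (m - 1 + √(m : ℝ)) * u ≤ 2 * (m * u) := by nlinarith
  have h3 := Real.exp_le_exp.mpr h2
  have h4 := exp_le_inv_one_sub (y := 2 * (m * u)) (by linarith)
  have hmu : 0 ≤ (m : ℝ) * u := by positivity
  have h5 : 1 / (1 - 2 * (m * u)) ≤ 1 + 3 * (m * u) := by
    rw [div_le_iff₀ (by linarith)]
    nlinarith
  linarith

/-- The factor is at most $1/((1-y)(1-u))-1$, where $y$ collects two product errors and one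
division. Thus the index $2(m-1+\sqrt m)+2$ would suffice. -/
theorem errorFactor_le_gam {u : ℝ} (hu : 0 ≤ u) {m : ℕ} (hm : 0 < m)
    (h : ((m : ℝ) * √(m : ℝ) + m + 2) * u < 1) :
    (1 + accErr m u) * ((1 + u) * (1 + accErr m u) / (1 - u)) - 1 ≤
      gam u ((m : ℝ) * √(m : ℝ) + m + 2) := by
  have hm1 : (1 : ℝ) ≤ m := by exact_mod_cast hm
  set w := √(m : ℝ) with hw
  have hw1 : 1 ≤ w := Real.one_le_sqrt.mpr hm1
  have hww : w * w = m := Real.mul_self_sqrt (by linarith)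
  have he := one_add_accErr_le hu hm
  rw [← hw] at he
  have he0 := accErr_nonneg hu m
  -- With $w=\sqrt m$ the difference of the sides is $(w-1)(w^2-2)$, nonnegative for $m=1$ and for
  -- $m\ge2$ but not in between; hence the case split.
  have hk : 2 * ((m : ℝ) - 1 + w) + 2 ≤ m * w + m + 2 := by
    rcases Nat.lt_or_ge m 2 with h2 | h2
    · have : m = 1 := by omega
      subst this
      have : w = 1 := by rw [hw]; simp
      rw [this]; norm_num
    · have h2' : (2 : ℝ) ≤ m := by exact_mod_cast h2
      nlinarith
  set y := (2 * ((m : ℝ) - 1 + w) + 1) * u with hy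
  have hyk : y + u ≤ (m * w + m + 2) * u := by nlinarith
  have hu1 : u < 1 := by nlinarith
  have hprod : (1 + accErr m u) * ((1 + u) * (1 + accErr m u)) ≤ 1 / (1 - y) := by
    refine le_trans ?_ (exp_le_inv_one_sub (by linarith))
    have : Real.exp y = Real.exp ((m - 1 + w) * u) * (Real.exp u * Real.exp ((m - 1 + w) * u)) := by
      rw [← Real.exp_add, ← Real.exp_add]
      congr 1
      rw [hy]; ring
    rw [this]
    have := Real.add_one_le_exp u
    gcongr
    linarith
  have hg : gam u (m * w + m + 2) = 1 / (1 - (m * w + m + 2) * u) - 1 := by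
    have : 1 - (m * w + m + 2) * u ≠ 0 := by linarith
    rw [gam, eq_sub_iff_add_eq, div_add_one this, add_sub_cancel]
  rw [hg]
  have hfin : 1 / (1 - y) / (1 - u) ≤ 1 / (1 - (m * w + m + 2) * u) := by
    rw [div_div]
    refine one_div_le_one_div_of_le (by linarith) ?_
    have : 0 ≤ y * u := by
      have : 0 ≤ y := by
        rw [hy]
        refine mul_nonneg (by linarith) hu
      positivity
    nlinarith
  have : (1 + accErr m u) * ((1 + u) * (1 + accErr m u) / (1 - u)) ≤ 1 / (1 - y) / (1 - u) := by
    rw [← mul_div_assoc]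
    exact div_le_div_of_nonneg_right hprod (by linarith)
  linarith

section Run

variable {m n : ℕ} {u : ℝ} {τ σ : SumTree m} {A : Matrix (Fin m) (Fin m) ℝ}
  {Z : Matrix (Fin m) (Fin n) ℝ} {c : Computed m n}

theorem IsRun.diag_pos (hc : IsRun u τ σ A Z c) (hu1 : u < 1) (j : Fin n) : 0 < c.r j j := by
  obtain ⟨δ, hδ, h⟩ := hc.diag j
  rw [h]
  have := Real.sqrt_pos.mpr (hc.radicand_pos j)
  have := neg_abs_le δ
  exact mul_pos ‹_› (by linarith)

theorem FlScale.vnorm_sub_le {x y : Fin m → ℝ} {r : ℝ} (hu : 0 ≤ u) (hr : 0 < r)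
    (h : FlScale u x r y) : vnorm (r • y - x) ≤ u * vnorm x := by
  refine vnorm_le_mul hu fun k => ?_
  obtain ⟨δ, hδ, hy⟩ := h k
  have : (r • y - x) k = δ * x k := by
    simp only [Pi.sub_apply, Pi.smul_apply, smul_eq_mul, hy]
    field_simp
    ring
  rw [this, abs_mul]
  gcongr

theorem IsRun.vnorm_x_sub_le (hc : IsRun u τ σ A Z c) (hu : 0 ≤ u) (hσ : σ.Complete) (j : Fin n) :
    vnorm (c.x j - A *ᵥ c.z j j) ≤ accErr m u * (‖A‖ * vnorm (c.z j j)) :=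
  vnorm_flDot_sub_le hu hσ A _ _ (hc.mulVec j)

theorem IsRun.vnorm_x_le (hc : IsRun u τ σ A Z c) (hu : 0 ≤ u) (hσ : σ.Complete) (j : Fin n) :
    vnorm (c.x j) ≤ (1 + accErr m u) * (‖A‖ * vnorm (c.z j j)) := by
  have h1 := hc.vnorm_x_sub_le hu hσ j
  have h2 := vnorm_add_le (c.x j - A *ᵥ c.z j j) (A *ᵥ c.z j j)
  rw [sub_add_cancel] at h2
  linarith [vnorm_mulVec_le A (c.z j j)]

theorem IsRun.vnorm_z_le (hc : IsRun u τ σ A Z c) (hu : 0 ≤ u) (hu1 : u < 1) (j : Fin n) :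
    (1 - u) * vnorm (c.z j j) ≤ c.r j j * vnorm (c.q j) := by
  have hr := hc.diag_pos hu1 j
  have h1 := (hc.scale_q j).vnorm_sub_le hu hr
  have h2 := vnorm_sub_le (c.r j j • c.q j) (c.r j j • c.q j - c.z j j)
  rw [sub_sub_cancel, vnorm_smul, abs_of_pos hr] at h2
  linarith

/-- Both $q_j$ and $p_j$ are obtained by dividing by the same computed $r_{jj}$, so the accuracy of
$r_{jj}$ plays no role: $r_{jj}(p_j-Aq_j)$ splits into the two division errors and the error of
$Az$. -/
theorem IsRun.vnorm_p_sub_le (hc : IsRun u τ σ A Z c) (hu : 0 ≤ u) (hu1 : u < 1)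
    (hσ : σ.Complete) (j : Fin n) :
    vnorm (c.p j - A *ᵥ c.q j) ≤
      ((1 + u) * (1 + accErr m u) / (1 - u) - 1) * (‖A‖ * vnorm (c.q j)) := by
  have hr := hc.diag_pos hu1 j
  have hq := (hc.scale_q j).vnorm_sub_le hu hr
  have hp := (hc.scale_p j).vnorm_sub_le hu hr
  have hx := hc.vnorm_x_sub_le hu hσ j
  have hx' := hc.vnorm_x_le hu hσ j
  have hz := hc.vnorm_z_le hu hu1 j
  have he := accErr_nonneg hu m
  have hA := norm_nonneg A
  have hzn := vnorm_nonneg (c.z j j)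
  have hdec : c.r j j • (c.p j - A *ᵥ c.q j) =
      (c.r j j • c.p j - c.x j) + ((c.x j - A *ᵥ c.z j j) - A *ᵥ (c.r j j • c.q j - c.z j j)) := by
    rw [Matrix.mulVec_sub, Matrix.mulVec_smul, smul_sub]
    abel
  have h1 := vnorm_smul (c.r j j) (c.p j - A *ᵥ c.q j)
  rw [abs_of_pos hr, hdec] at h1
  have h2 := vnorm_add_le (c.r j j • c.p j - c.x j)
    ((c.x j - A *ᵥ c.z j j) - A *ᵥ (c.r j j • c.q j - c.z j j))
  have h3 := vnorm_sub_le (c.x j - A *ᵥ c.z j j) (A *ᵥ (c.r j j • c.q j - c.z j j))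
  have h4 := vnorm_mulVec_le A (c.r j j • c.q j - c.z j j)
  have h5 := mul_le_mul_of_nonneg_left hq hA
  have h6 := mul_le_mul_of_nonneg_left hx' hu
  set e := accErr m u
  have h7 : c.r j j * vnorm (c.p j - A *ᵥ c.q j) ≤
      ((1 + u) * (1 + e) - (1 - u)) * (‖A‖ * vnorm (c.z j j)) := by linarith
  have hcoef : 0 ≤ (1 + u) * (1 + e) - (1 - u) := by
    have : 0 ≤ u * e := by positivity
    linarith
  have h8 : vnorm (c.z j j) ≤ c.r j j * vnorm (c.q j) / (1 - u) := by
    rw [le_div_iff₀ (by linarith)]; linarith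
  have h9 : c.r j j * vnorm (c.p j - A *ᵥ c.q j) ≤
      ((1 + u) * (1 + e) - (1 - u)) * (‖A‖ * (c.r j j * vnorm (c.q j) / (1 - u))) := by
    refine h7.trans ?_
    gcongr
  have h10 : ((1 + u) * (1 + e) - (1 - u)) * (‖A‖ * (c.r j j * vnorm (c.q j) / (1 - u))) =
      c.r j j * (((1 + u) * (1 + e) / (1 - u) - 1) * (‖A‖ * vnorm (c.q j))) := by
    have : 1 - u ≠ 0 := by linarith
    field_simp
  rw [h10] at h9
  exact le_of_mul_le_mul_left h9 hr

theorem IsRun.abs_r_sub_le (hc : IsRun u τ σ A Z c) (hA : A.IsHermitian) (hu : 0 ≤ u)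
    (hτ : τ.Complete) (hσ : σ.Complete) (h : ((m : ℝ) * √(m : ℝ) + m + 2) * u < 1)
    {i j : Fin n} (hij : i < j) :
    |c.r i j - c.q i ⬝ᵥ A *ᵥ c.z j i| ≤
      gam u ((m : ℝ) * √(m : ℝ) + m + 2) * ‖A‖ * vnorm (c.q i) * vnorm (c.z j i) := by
  have hu1 : u < 1 := by
    have : 0 ≤ (m : ℝ) * √(m : ℝ) := by positivity
    have : (0 : ℝ) ≤ m := by positivity
    nlinarith
  have hp := hc.vnorm_p_sub_le hu hu1 hσ i
  have hr := (hc.offdiag i j hij).abs_sub_le hu hτ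
  have he := accErr_nonneg hu m
  set e := accErr m u with he'
  set f := (1 + u) * (1 + e) / (1 - u) with hf
  have hsym : c.q i ⬝ᵥ A *ᵥ c.z j i = (A *ᵥ c.q i) ⬝ᵥ c.z j i := by
    rw [dotProduct_mulVec_transpose]
    congr 2
  have hpn : vnorm (c.p i) ≤ f * (‖A‖ * vnorm (c.q i)) := by
    have h1 := vnorm_add_le (c.p i - A *ᵥ c.q i) (A *ᵥ c.q i)
    rw [sub_add_cancel] at h1
    linarith [vnorm_mulVec_le A (c.q i)]
  have h1 := abs_dotProduct_le (c.p i - A *ᵥ c.q i) (c.z j i)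
  have h2 : c.r i j - c.q i ⬝ᵥ A *ᵥ c.z j i =
      (c.r i j - c.p i ⬝ᵥ c.z j i) + (c.p i - A *ᵥ c.q i) ⬝ᵥ c.z j i := by
    rw [hsym, sub_dotProduct]; ring
  have hz := vnorm_nonneg (c.z j i)
  have hq := vnorm_nonneg (c.q i)
  have hAn := norm_nonneg A
  rw [h2]
  calc _ ≤ |c.r i j - c.p i ⬝ᵥ c.z j i| + |(c.p i - A *ᵥ c.q i) ⬝ᵥ c.z j i| := abs_add_le _ _
    _ ≤ e * (f * (‖A‖ * vnorm (c.q i)) * vnorm (c.z j i)) +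
        (f - 1) * (‖A‖ * vnorm (c.q i)) * vnorm (c.z j i) := by
        refine add_le_add (hr.trans ?_) (h1.trans ?_) <;> gcongr
    _ = ((1 + e) * f - 1) * (‖A‖ * vnorm (c.q i) * vnorm (c.z j i)) := by ring
    _ ≤ gam u ((m : ℝ) * √(m : ℝ) + m + 2) * (‖A‖ * vnorm (c.q i) * vnorm (c.z j i)) := by
        gcongr
        exact errorFactor_le_gam hu hτ.pos h
    _ = _ := by ring

end Run

/-! ### Perturbed modified Gram-Schmidt: a priori bounds -/

/-- Expanding gives $\|v\|^2-r^2(2-w^Tw)+2re$, where $2-w^Tw\ge3/4$ and $2re\le r^2/4+4e^2$. The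
error $e$ enters only through its square, since it moves the result along $w$, to which the exact
residual is nearly orthogonal. -/
theorem vnorm_sub_smul_sq_add_le {m : ℕ} (v w : Fin m → ℝ) {r e : ℝ} (hr : r = w ⬝ᵥ v + e)
    (hw : |1 - w ⬝ᵥ w| ≤ 1 / 4) :
    r ^ 2 / 2 + vnorm (v - r • w) ^ 2 ≤ vnorm v ^ 2 + 4 * e ^ 2 := by
  have h1 : vnorm (v - r • w) ^ 2 = vnorm v ^ 2 - r ^ 2 * (2 - w ⬝ᵥ w) + 2 * r * e := by
    rw [vnorm_sq, vnorm_sq]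
    simp only [sub_dotProduct, dotProduct_sub, smul_dotProduct, dotProduct_smul, smul_eq_mul,
      dotProduct_comm v w]
    have : w ⬝ᵥ v = r - e := by linarith
    rw [this]; ring
  have h2 := (abs_le.mp hw).1
  rw [h1]
  nlinarith [sq_nonneg (r - 4 * e), sq_nonneg r]

section Perturbed

variable {m n : ℕ} {W : Matrix (Fin m) (Fin n) ℝ} {R Er : Matrix (Fin n) (Fin n) ℝ}
  {Y : ℕ → Matrix (Fin m) (Fin n) ℝ} {G : Fin n → Matrix (Fin m) (Fin n) ℝ} {a g : ℝ}

theorem vnorm_mulVec_sub_le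
    (hR : ∀ i : Fin n, R i = W.col i ᵥ* Y i + Er i)
    (hW : ∀ i, |1 - W.col i ⬝ᵥ W.col i| ≤ 1 / 4)
    (hEr : ∀ i : Fin n, vnorm (Er i) ≤ a * ‖Y i‖) (i : Fin n) (x : Fin n → ℝ) :
    (R *ᵥ x) i ^ 2 / 2 + vnorm ((Y i - Matrix.vecMulVec (W.col i) (R i)) *ᵥ x) ^ 2 ≤
      vnorm (Y i *ᵥ x) ^ 2 + 4 * (a * ‖Y i‖ * vnorm x) ^ 2 := by
  have h1 : (R *ᵥ x) i = W.col i ⬝ᵥ Y i *ᵥ x + Er i ⬝ᵥ x := by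
    change R i ⬝ᵥ x = _
    rw [hR i, add_dotProduct, Matrix.dotProduct_mulVec]
  have h2 := vnorm_sub_smul_sq_add_le (Y i *ᵥ x) (W.col i) h1 (hW i)
  have h3 : (Y i - Matrix.vecMulVec (W.col i) (R i)) *ᵥ x = Y i *ᵥ x - (R *ᵥ x) i • W.col i := by
    rw [Matrix.sub_mulVec]
    congr 1
    ext k
    simp only [Matrix.mulVec, dotProduct, Matrix.vecMulVec_apply, Pi.smul_apply, smul_eq_mul,
      Finset.sum_mul]
    exact Finset.sum_congr rfl fun j _ => by ring
  rw [h3]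
  have h4 : (Er i ⬝ᵥ x) ^ 2 ≤ (a * ‖Y i‖ * vnorm x) ^ 2 := by
    refine sq_le_sq' ?_ ?_
    all_goals
      have h5 := abs_dotProduct_le (Er i) x
      have h6 := mul_le_mul_of_nonneg_right (hEr i) (vnorm_nonneg x)
      have := abs_le.mp (h5.trans h6)
      linarith
  linarith

theorem norm_succ_le
    (hY : ∀ i : Fin n, Y (i + 1) = Y i - Matrix.vecMulVec (W.col i) (R i) + G i)
    (hR : ∀ i : Fin n, R i = W.col i ᵥ* Y i + Er i)
    (hW : ∀ i, |1 - W.col i ⬝ᵥ W.col i| ≤ 1 / 4)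
    (hEr : ∀ i : Fin n, vnorm (Er i) ≤ a * ‖Y i‖)
    (hG : ∀ i : Fin n, ‖G i‖ ≤ g * ‖Y i‖) (i : Fin n) :
    ‖Y (i + 1)‖ ≤ (1 + (2 * a ^ 2 + g)) * ‖Y i‖ := by
  have h1 : ‖Y i - Matrix.vecMulVec (W.col i) (R i)‖ ≤ (1 + 2 * a ^ 2) * ‖Y i‖ := by
    refine norm_le_of_vnorm_mulVec_le (by positivity) fun x => ?_
    have hx := vnorm_nonneg x
    have h2 := vnorm_mulVec_sub_le hR hW hEr i x
    have h3 := vnorm_mulVec_le (Y i) x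
    have h4 := pow_le_pow_left₀ (vnorm_nonneg _) h3 2
    refine le_of_sq_le_sq ?_ (by positivity)
    have h5 := sq_nonneg ((R *ᵥ x) i)
    have h6 : 0 ≤ (2 * a ^ 2 * ‖Y i‖ * vnorm x) ^ 2 := sq_nonneg _
    nlinarith
  rw [hY]
  have := norm_add_le (Y i - Matrix.vecMulVec (W.col i) (R i)) (G i)
  linarith [hG i]

/-- The coefficient errors accumulate as $na^2$ instead of $na$. For $a\sim mu\kappa$ and $n\le m$
this stays under control when $m^{3/2}u\kappa$ is small; a linear accumulation would require
smallness of $m^2u\kappa$. -/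
theorem norm_le_two_mul (hg : 0 ≤ g)
    (hY : ∀ i : Fin n, Y (i + 1) = Y i - Matrix.vecMulVec (W.col i) (R i) + G i)
    (hR : ∀ i : Fin n, R i = W.col i ᵥ* Y i + Er i)
    (hW : ∀ i, |1 - W.col i ⬝ᵥ W.col i| ≤ 1 / 4)
    (hEr : ∀ i : Fin n, vnorm (Er i) ≤ a * ‖Y i‖)
    (hG : ∀ i : Fin n, ‖G i‖ ≤ g * ‖Y i‖)
    (hs : n * (2 * a ^ 2 + g) ≤ 1 / 8) {i : ℕ} (hi : i ≤ n) : ‖Y i‖ ≤ 2 * ‖Y 0‖ := by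
  have hb : 0 ≤ 2 * a ^ 2 + g := by positivity
  have key : ∀ i ≤ n, ‖Y i‖ ≤ (1 + (2 * a ^ 2 + g)) ^ i * ‖Y 0‖ := by
    intro i
    induction i with
    | zero => intro _; simp
    | succ k ih =>
      intro hk
      have h1 := norm_succ_le hY hR hW hEr hG ⟨k, hk⟩
      have h2 := ih (by omega)
      rw [pow_succ]
      calc _ ≤ _ := h1
        _ ≤ (1 + (2 * a ^ 2 + g)) * ((1 + (2 * a ^ 2 + g)) ^ k * ‖Y 0‖) := by gcongr
        _ = _ := by ring
  refine (key i hi).trans ?_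
  gcongr
  have h1 : (1 + (2 * a ^ 2 + g)) ^ i ≤ Real.exp (2 * a ^ 2 + g) ^ i := by
    gcongr
    linarith [Real.add_one_le_exp (2 * a ^ 2 + g)]
  rw [← Real.exp_nat_mul] at h1
  have h2 : (i : ℝ) * (2 * a ^ 2 + g) ≤ 1 / 8 := by
    refine le_trans ?_ hs
    gcongr
  have h3 := exp_le_inv_one_sub (y := (i : ℝ) * (2 * a ^ 2 + g)) (by linarith)
  refine h1.trans (h3.trans ?_)
  rw [div_le_iff₀ (by linarith)]
  linarith

/-- Each step pays for $(Rx)_i^2/2$ with a decrease of $\|Y_ix\|^2$; the decreases telescope to at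
most $\|Y_0x\|^2$. Near-orthogonality between different columns of $W$ is not used. -/
theorem norm_coef_le (ha : 0 ≤ a) (hg : 0 ≤ g)
    (hY : ∀ i : Fin n, Y (i + 1) = Y i - Matrix.vecMulVec (W.col i) (R i) + G i)
    (hR : ∀ i : Fin n, R i = W.col i ᵥ* Y i + Er i)
    (hW : ∀ i, |1 - W.col i ⬝ᵥ W.col i| ≤ 1 / 4)
    (hEr : ∀ i : Fin n, vnorm (Er i) ≤ a * ‖Y i‖)
    (hG : ∀ i : Fin n, ‖G i‖ ≤ g * ‖Y i‖)
    (hs : n * (2 * a ^ 2 + g) ≤ 1 / 8) : ‖R‖ ≤ 2 * ‖Y 0‖ := by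
  refine norm_le_of_vnorm_mulVec_le (by positivity) fun x => ?_
  have hx := vnorm_nonneg x
  set X := ‖Y 0‖ * vnorm x with hX
  have hX0 : 0 ≤ X := by positivity
  have hstep : ∀ i : Fin n, (R *ᵥ x) i ^ 2 / 2 ≤
      (vnorm (Y i *ᵥ x) ^ 2 - vnorm (Y (i + 1) *ᵥ x) ^ 2) + (8 * g + 16 * a ^ 2) * X ^ 2 := by
    intro i
    have h1 := vnorm_mulVec_sub_le hR hW hEr i x
    have hYi := norm_le_two_mul hg hY hR hW hEr hG hs (i := i) i.2.le
    have hYi' := norm_le_two_mul hg hY hR hW hEr hG hs (i := i + 1) i.2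
    have h2 : Y (i + 1) *ᵥ x =
        (Y i - Matrix.vecMulVec (W.col i) (R i)) *ᵥ x + G i *ᵥ x := by
      rw [hY, Matrix.add_mulVec]
    have h3 := vnorm_add_le ((Y i - Matrix.vecMulVec (W.col i) (R i)) *ᵥ x) (G i *ᵥ x)
    rw [← h2] at h3
    have h4 : vnorm (G i *ᵥ x) ≤ 2 * g * X := by
      refine (vnorm_mulVec_le _ _).trans ?_
      have h5 : ‖G i‖ ≤ g * (2 * ‖Y 0‖) := (hG i).trans (by gcongr)
      calc _ ≤ g * (2 * ‖Y 0‖) * vnorm x := by gcongr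
        _ = _ := by rw [hX]; ring
    have h5 : vnorm (Y (i + 1) *ᵥ x) ≤ 2 * X := by
      refine (vnorm_mulVec_le _ _).trans ?_
      calc _ ≤ (2 * ‖Y 0‖) * vnorm x := by gcongr
        _ = _ := by rw [hX]; ring
    have h6 : a * ‖Y i‖ * vnorm x ≤ 2 * a * X := by
      calc _ ≤ a * (2 * ‖Y 0‖) * vnorm x := by gcongr
        _ = _ := by rw [hX]; ring
    have h7 := pow_le_pow_left₀ (by positivity) h6 2
    have h8 := vnorm_nonneg (Y (i + 1) *ᵥ x)
    have h9 := vnorm_nonneg (G i *ᵥ x)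
    have h10 := vnorm_nonneg ((Y i - Matrix.vecMulVec (W.col i) (R i)) *ᵥ x)
    have h11 := mul_le_mul h5 h4 h9 (by positivity)
    have h12 : vnorm (Y (i + 1) *ᵥ x) ^ 2 - 2 * (vnorm (Y (i + 1) *ᵥ x) * vnorm (G i *ᵥ x)) ≤
        vnorm ((Y i - Matrix.vecMulVec (W.col i) (R i)) *ᵥ x) ^ 2 := by
      rcases le_total (vnorm (Y (i + 1) *ᵥ x)) (vnorm (G i *ᵥ x)) with h | h
      · nlinarith
      · nlinarith [pow_le_pow_left₀ (sub_nonneg.mpr h) (sub_le_iff_le_add.mpr h3) 2]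
    linarith
  have hsum : ∑ i, (R *ᵥ x) i ^ 2 / 2 ≤
      vnorm (Y 0 *ᵥ x) ^ 2 + n * ((8 * g + 16 * a ^ 2) * X ^ 2) := by
    refine (Finset.sum_le_sum fun i _ => hstep i).trans ?_
    rw [Finset.sum_add_distrib,
      ← Finset.sum_range (fun i => vnorm (Y i *ᵥ x) ^ 2 - vnorm (Y (i + 1) *ᵥ x) ^ 2),
      Finset.sum_range_sub']
    have := sq_nonneg (vnorm (Y n *ᵥ x))
    simp only [Finset.sum_const, Finset.card_univ, Fintype.card_fin, nsmul_eq_mul]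
    linarith
  have hRx : vnorm (R *ᵥ x) ^ 2 = 2 * ∑ i, (R *ᵥ x) i ^ 2 / 2 := by
    rw [vnorm_sq, Finset.mul_sum]
    exact Finset.sum_congr rfl fun i _ => by ring
  have h0 := pow_le_pow_left₀ (vnorm_nonneg _) (vnorm_mulVec_le (Y 0) x) 2
  rw [← hX] at h0
  -- The bound $1/8$ is chosen so that the accumulated errors, $8n(2a^2+g)X^2$, are at most $X^2$.
  have hs' : (n : ℝ) * ((8 * g + 16 * a ^ 2) * X ^ 2) ≤ X ^ 2 := by
    have := mul_le_mul_of_nonneg_right hs (sq_nonneg X)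
    linarith
  refine le_of_sq_le_sq ?_ (by positivity)
  rw [hRx, mul_assoc, ← hX, mul_pow]
  linarith

end Perturbed

/-! ### Perturbed modified Gram-Schmidt: loss of orthogonality -/

theorem sum_vecMulVec_eq_mul {m n : ℕ} (p : Fin n → Prop) [DecidablePred p]
    (Q : Matrix (Fin m) (Fin n) ℝ) (R : Matrix (Fin n) (Fin n) ℝ) :
    ∑ k with p k, Matrix.vecMulVec (Q.col k) (R k) =
      Q * (Matrix.of fun k j => if p k then R k j else 0 : Matrix (Fin n) (Fin n) ℝ) := by
  ext a b
  simp [Matrix.mul_apply, Matrix.sum_apply, Matrix.vecMulVec_apply, Finset.sum_filter]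

/-- Telescoping from the end, where nothing is left; the induction is on $n-i$. -/
theorem stage_eq_sum {m n : ℕ} {Q : Matrix (Fin m) (Fin n) ℝ} {R : Matrix (Fin n) (Fin n) ℝ}
    {S : ℕ → Matrix (Fin m) (Fin n) ℝ} {F : Fin n → Matrix (Fin m) (Fin n) ℝ}
    (hS : ∀ i : Fin n, S (i + 1) = S i - Matrix.vecMulVec (Q.col i) (R i) + F i)
    (hSn : S n = 0) {i : ℕ} (hi : i ≤ n) :
    S i = ∑ k ∈ Finset.univ.filter fun k : Fin n => i ≤ (k : ℕ),
      (Matrix.vecMulVec (Q.col k) (R k) - F k) := by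
  obtain ⟨d, hd⟩ := Nat.exists_eq_add_of_le hi
  induction d generalizing i with
  | zero =>
    have : i = n := by omega
    subst this
    rw [hSn, Finset.sum_filter, Finset.sum_eq_zero]
    intro k _
    rw [if_neg (by have := k.2; omega)]
  | succ d ih =>
    have hin : i < n := by omega
    have h1 := hS ⟨i, hin⟩
    have h2 : (Finset.univ.filter fun k : Fin n => i ≤ (k : ℕ)) =
        insert ⟨i, hin⟩ (Finset.univ.filter fun k : Fin n => i + 1 ≤ (k : ℕ)) := by
      ext k
      simp only [Finset.mem_filter, Finset.mem_univ, true_and, Finset.mem_insert, Fin.ext_iff]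
      omega
    rw [h2, Finset.sum_insert (by simp), ← ih (i := i + 1) hin (by omega), h1]
    abel

/-- The part of a square matrix strictly above its diagonal. -/
def strictUpper {n : ℕ} (B : Matrix (Fin n) (Fin n) ℝ) : Matrix (Fin n) (Fin n) ℝ :=
  Matrix.of fun i k => if i < k then B i k else 0

theorem strictUpper_add_transpose {n : ℕ} {B : Matrix (Fin n) (Fin n) ℝ} (hB : Bᵀ = B) :
    B - 1 = strictUpper B + (strictUpper B)ᵀ - Matrix.diagonal fun i => 1 - B i i := by
  ext i k
  simp only [strictUpper, Matrix.sub_apply, Matrix.add_apply, Matrix.transpose_apply,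
    Matrix.of_apply, Matrix.diagonal_apply, Matrix.one_apply]
  rcases lt_trichotomy i k with h | h | h
  · simp [h, h.ne, h.not_gt]
  · subst h; simp
  · have : B i k = B k i := by conv_lhs => rw [← hB, Matrix.transpose_apply]
    simp [h, h.ne', h.not_gt, this]

/-- Replacing $S_i$ in the formula for row $i$ of $R$ by its telescoped sum produces $\sum_{k\ge
i}(Q^TAQ)_{ik}R_k$. The term $k=i$ combines with $R_i$ on the left to give the diagonal defect, and
the terms $k>i$ are row $i$ of the product on the left of the claim. -/
theorem strictUpper_mul_eq {m n : ℕ} {A : Matrix (Fin m) (Fin m) ℝ}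
    {Q : Matrix (Fin m) (Fin n) ℝ} {R Er : Matrix (Fin n) (Fin n) ℝ}
    {S : ℕ → Matrix (Fin m) (Fin n) ℝ} {F : Fin n → Matrix (Fin m) (Fin n) ℝ}
    (hS : ∀ i : Fin n, S (i + 1) = S i - Matrix.vecMulVec (Q.col i) (R i) + F i)
    (hSn : S n = 0) (hR : ∀ i j : Fin n, R i j = (Qᵀ * A * S i) i j + Er i j) :
    strictUpper (Qᵀ * A * Q) * R =
      Matrix.diagonal (fun i => 1 - (Qᵀ * A * Q) i i) * R +
        ∑ k : Fin n, (Matrix.of fun i j => if i ≤ k then (Qᵀ * A * F k) i j else 0 :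
          Matrix (Fin n) (Fin n) ℝ) - Er := by
  ext i j
  have h1 := hR i j
  rw [stage_eq_sum hS hSn i.2.le, Matrix.mul_sum, Matrix.sum_apply] at h1
  have h2 : ∀ k : Fin n, (Qᵀ * A * (Matrix.vecMulVec (Q.col k) (R k) - F k)) i j =
      (Qᵀ * A * Q) i k * R k j - (Qᵀ * A * F k) i j := by
    intro k
    rw [Matrix.mul_sub, Matrix.sub_apply, Matrix.mul_vecMulVec, Matrix.vecMulVec_apply]
    rfl
  simp only [h2, Finset.sum_sub_distrib, Finset.sum_filter] at h1
  simp only [Matrix.sub_apply, Matrix.add_apply, Matrix.sum_apply, Matrix.diagonal_mul,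
    Matrix.of_apply]
  have h3 : (strictUpper (Qᵀ * A * Q) * R) i j =
      (∑ k : Fin n, if (i : ℕ) ≤ k then (Qᵀ * A * Q) i k * R k j else 0) -
        (Qᵀ * A * Q) i i * R i j := by
    have h4 : (Qᵀ * A * Q) i i * R i j =
        ∑ k : Fin n, if k = i then (Qᵀ * A * Q) i k * R k j else 0 := by simp
    rw [h4, ← Finset.sum_sub_distrib, Matrix.mul_apply]
    refine Finset.sum_congr rfl fun k _ => ?_
    simp only [strictUpper, Matrix.of_apply]
    rcases lt_trichotomy i k with h | h | h
    · have h' : (i : ℕ) ≤ k := h.le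
      simp [h, h', h.ne']
    · subst h; simp
    · have h' : ¬ (i : ℕ) ≤ k := not_le.mpr h
      simp [h.not_gt, h', h.ne]
  have h5 : ∀ k : Fin n, (i ≤ k) = ((i : ℕ) ≤ k) := fun k => rfl
  simp only [h5]
  rw [h3]
  linarith

/-- The lower bound makes $R$ injective, hence invertible, so every vector is some $Rx$. -/
theorem norm_le_of_norm_mul_le {n : ℕ} {U R : Matrix (Fin n) (Fin n) ℝ} {s e : ℝ} (hs : 0 < s)
    (he : ‖U * R‖ ≤ e) (hR : ∀ x, s * vnorm x ≤ vnorm (R *ᵥ x)) : ‖U‖ ≤ e / s := by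
  have he0 : 0 ≤ e := (norm_nonneg _).trans he
  have hinj : Function.Injective R.mulVec := by
    intro x y hxy
    have h1 := hR (x - y)
    rw [Matrix.mulVec_sub] at h1
    have h2 : R *ᵥ x - R *ᵥ y = 0 := sub_eq_zero.mpr hxy
    rw [h2, vnorm_zero] at h1
    have h3 : vnorm (x - y) = 0 := by
      have := vnorm_nonneg (x - y)
      nlinarith
    exact sub_eq_zero.mp (vnorm_eq_zero.mp h3)
  have hunit : IsUnit R := Matrix.mulVec_injective_iff_isUnit.mp hinj
  refine norm_le_of_vnorm_mulVec_le (by positivity) fun y => ?_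
  obtain ⟨x, rfl⟩ := (Matrix.mulVec_surjective_iff_isUnit.mpr hunit) y
  rw [Matrix.mulVec_mulVec, div_mul_eq_mul_div, le_div_iff₀ hs]
  have h1 := vnorm_mulVec_le (U * R) x
  have h2 := vnorm_nonneg x
  calc _ ≤ (e * vnorm x) * s := by
        gcongr
        exact h1.trans (by gcongr)
    _ = e * (s * vnorm x) := by ring
    _ ≤ _ := by gcongr; exact hR x

theorem norm_stage_le {m n : ℕ} {Q : Matrix (Fin m) (Fin n) ℝ} {R : Matrix (Fin n) (Fin n) ℝ}
    {S : ℕ → Matrix (Fin m) (Fin n) ℝ} {F : Fin n → Matrix (Fin m) (Fin n) ℝ}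
    (hS : ∀ i : Fin n, S (i + 1) = S i - Matrix.vecMulVec (Q.col i) (R i) + F i)
    (hSn : S n = 0) {i : ℕ} (hi : i ≤ n) : ‖S i‖ ≤ ‖Q‖ * ‖R‖ + ∑ k, ‖F k‖ := by
  rw [stage_eq_sum hS hSn hi, Finset.sum_sub_distrib, sum_vecMulVec_eq_mul]
  refine (norm_sub_le _ _).trans (add_le_add ?_ ?_)
  · refine (Matrix.l2_opNorm_mul _ _).trans ?_
    gcongr
    exact norm_mask_rows_le _ _
  · refine (norm_sum_le _ _).trans ?_
    exact Finset.sum_le_sum_of_subset_of_nonneg (Finset.subset_univ _)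
      fun k _ _ => norm_nonneg _

/-- The start of the process, in terms of the computed factors. -/
theorem stage_zero_eq {m n : ℕ} {Q : Matrix (Fin m) (Fin n) ℝ} {R : Matrix (Fin n) (Fin n) ℝ}
    {S : ℕ → Matrix (Fin m) (Fin n) ℝ} {F : Fin n → Matrix (Fin m) (Fin n) ℝ}
    (hS : ∀ i : Fin n, S (i + 1) = S i - Matrix.vecMulVec (Q.col i) (R i) + F i)
    (hSn : S n = 0) : S 0 = Q * R - ∑ k, F k := by
  rw [stage_eq_sum hS hSn n.zero_le, Finset.sum_sub_distrib, sum_vecMulVec_eq_mul]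
  have h1 : (Matrix.of fun (k : Fin n) j => if 0 ≤ (k : ℕ) then R k j else 0) = R := by
    ext k j; simp
  rw [h1]
  simp

theorem norm_strictUpper_mul_le {m n : ℕ} {A : Matrix (Fin m) (Fin m) ℝ}
    {Q : Matrix (Fin m) (Fin n) ℝ} {R Er : Matrix (Fin n) (Fin n) ℝ}
    {S : ℕ → Matrix (Fin m) (Fin n) ℝ} {F : Fin n → Matrix (Fin m) (Fin n) ℝ} {d e : ℝ}
    (hS : ∀ i : Fin n, S (i + 1) = S i - Matrix.vecMulVec (Q.col i) (R i) + F i)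
    (hSn : S n = 0) (hR : ∀ i j : Fin n, R i j = (Qᵀ * A * S i) i j + Er i j)
    (hd0 : 0 ≤ d) (hd : ∀ i, |1 - (Qᵀ * A * Q) i i| ≤ d)
    (he0 : 0 ≤ e) (he : ∀ i, vnorm (Er i) ≤ e) :
    ‖strictUpper (Qᵀ * A * Q) * R‖ ≤
      d * ‖R‖ + ‖A‖ * ‖Q‖ * ∑ k, ‖F k‖ + √(n : ℝ) * e := by
  rw [strictUpper_mul_eq hS hSn hR]
  refine (norm_sub_le _ _).trans (add_le_add ((norm_add_le _ _).trans (add_le_add ?_ ?_)) ?_)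
  · refine (Matrix.l2_opNorm_mul _ _).trans ?_
    gcongr
    exact norm_diagonal_le hd0 hd
  · rw [Finset.mul_sum]
    refine (norm_sum_le _ _).trans (Finset.sum_le_sum fun k _ => ?_)
    refine (norm_mask_rows_le (fun i => i ≤ k) (Qᵀ * A * F k)).trans ?_
    refine (Matrix.l2_opNorm_mul _ _).trans ?_
    gcongr
    refine (Matrix.l2_opNorm_mul _ _).trans ?_
    rw [norm_transpose, mul_comm]
  · exact norm_le_of_row_le he0 he

theorem norm_gram_sub_one_le {n : ℕ} {B : Matrix (Fin n) (Fin n) ℝ} {d e : ℝ} (hB : Bᵀ = B)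
    (hd0 : 0 ≤ d) (hd : ∀ i, |1 - B i i| ≤ d) (he : ‖strictUpper B‖ ≤ e) :
    ‖B - 1‖ ≤ d + 2 * e := by
  rw [strictUpper_add_transpose hB]
  have h1 := norm_sub_le (strictUpper B + (strictUpper B)ᵀ)
    (Matrix.diagonal fun i => 1 - B i i)
  have h2 := norm_add_le (strictUpper B) (strictUpper B)ᵀ
  rw [norm_transpose] at h2
  have h3 := norm_diagonal_le hd0 hd
  linarith

theorem norm_one_le (n : ℕ) : ‖(1 : Matrix (Fin n) (Fin n) ℝ)‖ ≤ 1 := by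
  rw [← Matrix.diagonal_one]
  exact norm_diagonal_le zero_le_one fun i => by simp

/-- A perturbed modified Gram-Schmidt process in the inner product of `A = H * H`, with small local
errors. Here `S i` holds the vectors after `i` steps, `F i` the errors of the updates and `Er` the
errors of the coefficients. -/
structure IsPerturbedGramSchmidt {m n : ℕ} (A H : Matrix (Fin m) (Fin m) ℝ)
    (Q : Matrix (Fin m) (Fin n) ℝ) (R Er : Matrix (Fin n) (Fin n) ℝ)
    (S : ℕ → Matrix (Fin m) (Fin n) ℝ) (F : Fin n → Matrix (Fin m) (Fin n) ℝ)
    (u l ρ κ : ℝ) : Prop where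
  pos : 0 < n
  le : n ≤ m
  u_nonneg : 0 ≤ u
  symm : Hᵀ = H
  sq : H * H = A
  -- Here $l$ stands for the bound $\sigma_{\min}(A)^{-1/2}$ on $\|A^{-1/2}\|$, $\rho$ for the
  -- largest ratio $\|z\|/\|z\|_A$ met in the run, and $\kappa$ for $\kappa(A)$.
  l_nonneg : 0 ≤ l
  vnorm_le : ∀ v, vnorm v ≤ l * vnorm (H *ᵥ v)
  norm_mul_sq_le : ‖A‖ * l ^ 2 ≤ κ
  ρ_nonneg : 0 ≤ ρ
  ρ_le : ρ ≤ l
  step : ∀ i : Fin n, S (i + 1) = S i - Matrix.vecMulVec (Q.col i) (R i) + F i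
  finish : S n = 0
  coef : ∀ i j : Fin n, R i j = (Qᵀ * A * S i) i j + Er i j
  diag : ∀ i, |1 - (Qᵀ * A * Q) i i| ≤ 17 * (m * u) * ‖A‖ * vnorm (Q.col i) ^ 2
  col : ∀ i, vnorm (Q.col i) ≤ 2 * ρ
  coefErr : ∀ i : Fin n, vnorm (Er i) ≤ 32 * (m * u) * ‖A‖ * vnorm (Q.col i) * ‖S i‖
  stepErr : ∀ i : Fin n, ‖F i‖ ≤ 13 * u * ρ * √(n : ℝ) * ‖H * S i‖
  small : 1000000 * (m * √(m : ℝ) * u * κ) ≤ 1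

/-! ### Consequences of small local errors -/

theorem mul_le_mul_sqrt_mul {m : ℕ} {u : ℝ} (hm : 0 < m) (hu : 0 ≤ u) :
    m * u ≤ m * √(m : ℝ) * u := by
  have h : 1 ≤ √(m : ℝ) := Real.one_le_sqrt.mpr (by exact_mod_cast hm)
  gcongr
  exact le_mul_of_one_le_right (by positivity) h

theorem sqrt_mul_le_mul_sqrt_mul {m n : ℕ} {u : ℝ} (h : n ≤ m) (hu : 0 ≤ u) :
    √(n : ℝ) * (m * u) ≤ m * √(m : ℝ) * u := by
  calc √(n : ℝ) * (m * u) ≤ √(m : ℝ) * (m * u) := by gcongr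
    _ = _ := by ring

theorem mul_sqrt_le_mul_sqrt_mul {m n : ℕ} {u : ℝ} (h : n ≤ m) (hu : 0 ≤ u) :
    n * (u * √(n : ℝ)) ≤ m * √(m : ℝ) * u := by
  calc n * (u * √(n : ℝ)) ≤ m * (u * √(m : ℝ)) := by gcongr
    _ = _ := by ring

namespace IsPerturbedGramSchmidt

variable {m n : ℕ} {A H : Matrix (Fin m) (Fin m) ℝ}
  {Q : Matrix (Fin m) (Fin n) ℝ} {R Er : Matrix (Fin n) (Fin n) ℝ}
  {S : ℕ → Matrix (Fin m) (Fin n) ℝ} {F : Fin n → Matrix (Fin m) (Fin n) ℝ}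
  {u l ρ κ : ℝ}

theorem norm_eq (h : IsPerturbedGramSchmidt A H Q R Er S F u l ρ κ) : ‖A‖ = ‖H‖ ^ 2 := by
  rw [← h.sq, ← norm_transpose_mul_self, h.symm]

theorem one_le (h : IsPerturbedGramSchmidt A H Q R Er S F u l ρ κ) : 1 ≤ ‖H‖ * l := by
  have hm : 0 < m := h.pos.trans_le h.le
  set e : Fin m → ℝ := Pi.single ⟨0, hm⟩ 1
  have he : vnorm e = 1 := by simp [e, vnorm_single]
  have h1 := h.vnorm_le e
  have h2 := mul_le_mul_of_nonneg_left (vnorm_mulVec_le H e) h.l_nonneg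
  rw [he] at h1 h2
  linarith

/-- The square of $\|H\|l\ge1$ is at most $\kappa$, so the number itself is too. -/
theorem norm_mul_le (h : IsPerturbedGramSchmidt A H Q R Er S F u l ρ κ) : ‖H‖ * l ≤ κ := by
  have h1 := h.norm_mul_sq_le
  rw [h.norm_eq, ← mul_pow] at h1
  exact (le_self_pow₀ h.one_le two_ne_zero).trans h1

theorem κ_nonneg (h : IsPerturbedGramSchmidt A H Q R Er S F u l ρ κ) : 0 ≤ κ := by
  linarith [h.one_le, h.norm_mul_le]

theorem norm_mul_ρ_le (h : IsPerturbedGramSchmidt A H Q R Er S F u l ρ κ) : ‖H‖ * ρ ≤ κ :=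
  (mul_le_mul_of_nonneg_left h.ρ_le (norm_nonneg H)).trans h.norm_mul_le

theorem norm_sq_mul_le (h : IsPerturbedGramSchmidt A H Q R Er S F u l ρ κ) :
    ‖H‖ ^ 2 * ρ * l ≤ κ := by
  have h1 := h.norm_mul_sq_le
  rw [h.norm_eq] at h1
  have := h.l_nonneg
  refine le_trans ?_ h1
  calc ‖H‖ ^ 2 * ρ * l ≤ ‖H‖ ^ 2 * l * l := by gcongr; exact h.ρ_le
    _ = ‖H‖ ^ 2 * l ^ 2 := by ring

theorem gram_eq (h : IsPerturbedGramSchmidt A H Q R Er S F u l ρ κ)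
    (B : Matrix (Fin m) (Fin n) ℝ) : Qᵀ * A * B = (H * Q)ᵀ * (H * B) := by
  rw [Matrix.transpose_mul, h.symm, ← h.sq]
  simp only [Matrix.mul_assoc]

theorem col_dotProduct_col (h : IsPerturbedGramSchmidt A H Q R Er S F u l ρ κ) (i : Fin n) :
    (H * Q).col i ⬝ᵥ (H * Q).col i = (Qᵀ * A * Q) i i := by
  rw [h.gram_eq, Matrix.mul_apply]
  rfl

theorem norm_le_mul (h : IsPerturbedGramSchmidt A H Q R Er S F u l ρ κ)
    (B : Matrix (Fin m) (Fin n) ℝ) : ‖B‖ ≤ l * ‖H * B‖ := by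
  have := h.l_nonneg
  refine norm_le_of_vnorm_mulVec_le (by positivity) fun x => ?_
  refine (h.vnorm_le _).trans ?_
  rw [Matrix.mulVec_mulVec, mul_assoc]
  gcongr
  exact vnorm_mulVec_le _ _

theorem diag_small (h : IsPerturbedGramSchmidt A H Q R Er S F u l ρ κ) (i : Fin n) :
    |1 - (Qᵀ * A * Q) i i| ≤ 1 / 10000 := by
  have hu := h.u_nonneg
  have hρ := h.ρ_nonneg
  have hκ := h.κ_nonneg
  have hq := vnorm_nonneg (Q.col i)
  have hμ := mul_le_mul_sqrt_mul (h.pos.trans_le h.le) hu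
  have hsm := h.small
  refine (h.diag i).trans ?_
  rw [h.norm_eq]
  calc 17 * (m * u) * ‖H‖ ^ 2 * vnorm (Q.col i) ^ 2
      ≤ 17 * (m * u) * ‖H‖ ^ 2 * (2 * ρ) ^ 2 := by gcongr; exact h.col i
    _ = 68 * (m * u) * (‖H‖ ^ 2 * ρ * ρ) := by ring
    _ ≤ 68 * (m * √(m : ℝ) * u) * (‖H‖ ^ 2 * ρ * l) := by gcongr; exact h.ρ_le
    _ ≤ 68 * (m * √(m : ℝ) * u) * κ := by gcongr; exact h.norm_sq_mul_le
    _ ≤ 1 / 10000 := by linarith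

theorem diag_le (h : IsPerturbedGramSchmidt A H Q R Er S F u l ρ κ) (i : Fin n) :
    |1 - (Qᵀ * A * Q) i i| ≤ 34 * (m * √(m : ℝ) * u * ‖H‖ ^ 2 * ‖Q‖ * ρ) := by
  have hu := h.u_nonneg
  have hq := vnorm_nonneg (Q.col i)
  have hμ := mul_le_mul_sqrt_mul (h.pos.trans_le h.le) hu
  refine (h.diag i).trans ?_
  rw [h.norm_eq]
  have h1 : vnorm (Q.col i) ^ 2 ≤ ‖Q‖ * (2 * ρ) := by
    rw [pow_two]
    exact mul_le_mul (vnorm_col_le Q i) (h.col i) hq (norm_nonneg _)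
  calc 17 * (m * u) * ‖H‖ ^ 2 * vnorm (Q.col i) ^ 2
      ≤ 17 * (m * √(m : ℝ) * u) * ‖H‖ ^ 2 * (‖Q‖ * (2 * ρ)) := by gcongr
    _ = _ := by ring

theorem coef_row_eq (h : IsPerturbedGramSchmidt A H Q R Er S F u l ρ κ) (i : Fin n) :
    R i = (H * Q).col i ᵥ* (H * S i) + Er i := by
  ext j
  rw [h.coef i j, Pi.add_apply, h.gram_eq, Matrix.mul_apply]
  rfl

theorem mul_step (h : IsPerturbedGramSchmidt A H Q R Er S F u l ρ κ) (i : Fin n) :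
    H * S (i + 1) = H * S i - Matrix.vecMulVec ((H * Q).col i) (R i) + H * F i := by
  rw [h.step, Matrix.mul_add, Matrix.mul_sub, Matrix.mul_vecMulVec]
  rfl

theorem coefErr_le (h : IsPerturbedGramSchmidt A H Q R Er S F u l ρ κ) (i : Fin n) :
    vnorm (Er i) ≤ 64 * (m * u) * κ * ‖H * S i‖ := by
  have hu := h.u_nonneg
  have hq := vnorm_nonneg (Q.col i)
  have hρ := h.ρ_nonneg
  refine (h.coefErr i).trans ?_
  rw [h.norm_eq]
  calc 32 * (m * u) * ‖H‖ ^ 2 * vnorm (Q.col i) * ‖S i‖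
      ≤ 32 * (m * u) * ‖H‖ ^ 2 * (2 * ρ) * (l * ‖H * S i‖) := by
        gcongr
        exacts [h.col i, h.norm_le_mul _]
    _ = 64 * (m * u) * (‖H‖ ^ 2 * ρ * l) * ‖H * S i‖ := by ring
    _ ≤ _ := by gcongr; exact h.norm_sq_mul_le

theorem norm_mul_stepErr_le (h : IsPerturbedGramSchmidt A H Q R Er S F u l ρ κ) (i : Fin n) :
    ‖H * F i‖ ≤ 13 * u * √(n : ℝ) * κ * ‖H * S i‖ := by
  have hu := h.u_nonneg
  refine (Matrix.l2_opNorm_mul _ _).trans ?_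
  calc ‖H‖ * ‖F i‖ ≤ ‖H‖ * (13 * u * ρ * √(n : ℝ) * ‖H * S i‖) := by gcongr; exact h.stepErr i
    _ = 13 * u * √(n : ℝ) * (‖H‖ * ρ) * ‖H * S i‖ := by ring
    _ ≤ _ := by gcongr; exact h.norm_mul_ρ_le

theorem growth_le (h : IsPerturbedGramSchmidt A H Q R Er S F u l ρ κ) :
    n * (2 * (64 * (m * u) * κ) ^ 2 + 13 * u * √(n : ℝ) * κ) ≤ 1 / 8 := by
  have hu := h.u_nonneg
  have hκ := h.κ_nonneg
  have hsm := h.small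
  have h1 : √(n : ℝ) * (m * u) * κ ≤ m * √(m : ℝ) * u * κ :=
    mul_le_mul_of_nonneg_right (sqrt_mul_le_mul_sqrt_mul h.le hu) hκ
  have h2 : n * (u * √(n : ℝ)) * κ ≤ m * √(m : ℝ) * u * κ :=
    mul_le_mul_of_nonneg_right (mul_sqrt_le_mul_sqrt_mul h.le hu) hκ
  have h3 : (√(n : ℝ) * (m * u) * κ) ^ 2 ≤ (1 / 1000000) ^ 2 :=
    pow_le_pow_left₀ (by positivity) (by linarith) 2
  have h4 : n * (2 * (64 * (m * u) * κ) ^ 2 + 13 * u * √(n : ℝ) * κ) =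
      8192 * (√(n : ℝ) * (m * u) * κ) ^ 2 + 13 * (n * (u * √(n : ℝ)) * κ) := by
    have hrr : √(n : ℝ) ^ 2 = n := Real.sq_sqrt (Nat.cast_nonneg n)
    rw [mul_pow (√(n : ℝ) * (m * u)), mul_pow (√(n : ℝ)), hrr]
    ring
  rw [h4]
  norm_num at h3
  linarith

theorem norm_mul_stage_le (h : IsPerturbedGramSchmidt A H Q R Er S F u l ρ κ) {i : ℕ}
    (hi : i ≤ n) : ‖H * S i‖ ≤ 2 * ‖H * S 0‖ := by
  have hu := h.u_nonneg
  have hκ := h.κ_nonneg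
  exact norm_le_two_mul (Y := fun i => H * S i) (by positivity) h.mul_step h.coef_row_eq
    (fun i => by rw [h.col_dotProduct_col]; linarith [h.diag_small i]) h.coefErr_le
    h.norm_mul_stepErr_le h.growth_le hi

theorem norm_coef_le (h : IsPerturbedGramSchmidt A H Q R Er S F u l ρ κ) :
    ‖R‖ ≤ 2 * ‖H * S 0‖ := by
  have hu := h.u_nonneg
  have hκ := h.κ_nonneg
  exact MGSHA.norm_coef_le (Y := fun i => H * S i) (by positivity) (by positivity) h.mul_step
    h.coef_row_eq (fun i => by rw [h.col_dotProduct_col]; linarith [h.diag_small i]) h.coefErr_le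
    h.norm_mul_stepErr_le h.growth_le

theorem sum_stepErr_le (h : IsPerturbedGramSchmidt A H Q R Er S F u l ρ κ) :
    ∑ k, ‖F k‖ ≤ 26 * (m * √(m : ℝ) * u) * ρ * ‖H * S 0‖ := by
  have hu := h.u_nonneg
  have hρ := h.ρ_nonneg
  have h1 : ∀ k ∈ Finset.univ, ‖F k‖ ≤ 13 * u * ρ * √(n : ℝ) * (2 * ‖H * S 0‖) := fun k _ =>
    (h.stepErr k).trans (by gcongr; exact h.norm_mul_stage_le k.2.le)
  refine (Finset.sum_le_sum h1).trans ?_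
  simp only [Finset.sum_const, Finset.card_univ, Fintype.card_fin, nsmul_eq_mul]
  have h2 := mul_sqrt_le_mul_sqrt_mul h.le hu
  calc n * (13 * u * ρ * √(n : ℝ) * (2 * ‖H * S 0‖))
      = 26 * (n * (u * √(n : ℝ))) * ρ * ‖H * S 0‖ := by ring
    _ ≤ _ := by gcongr

theorem half_le (h : IsPerturbedGramSchmidt A H Q R Er S F u l ρ κ) : 1 / 2 ≤ ‖H‖ * ‖Q‖ := by
  have h1 := (abs_le.mp (h.diag_small ⟨0, h.pos⟩)).2
  rw [← h.col_dotProduct_col, ← vnorm_sq] at h1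
  have h2 : vnorm ((H * Q).col ⟨0, h.pos⟩) ≤ ‖H‖ * ‖Q‖ :=
    (vnorm_col_le _ _).trans (Matrix.l2_opNorm_mul _ _)
  have h3 := vnorm_nonneg ((H * Q).col ⟨0, h.pos⟩)
  nlinarith

/-- A column of $HQ$ has norm close to $1$, so $\|H\|\|Q\|\ge1/2$; comparing after multiplication by
$\|H\|$ lets the accumulated update errors be absorbed into $\|Q\|$. -/
theorem ρ_small (h : IsPerturbedGramSchmidt A H Q R Er S F u l ρ κ) :
    26 * (m * √(m : ℝ) * u) * ρ ≤ ‖Q‖ := by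
  have hu := h.u_nonneg
  have hsm := h.small
  have hwq := h.half_le
  have hw : 0 < ‖H‖ := by
    rcases (norm_nonneg H).eq_or_lt with h0 | h0
    · rw [← h0] at hwq
      linarith
    · exact h0
  refine le_of_mul_le_mul_left ?_ hw
  calc ‖H‖ * (26 * (m * √(m : ℝ) * u) * ρ) = 26 * (m * √(m : ℝ) * u * (‖H‖ * ρ)) := by ring
    _ ≤ 26 * (m * √(m : ℝ) * u * κ) := by gcongr; exact h.norm_mul_ρ_le
    _ ≤ ‖H‖ * ‖Q‖ := by linarith

/-- Bounding the stages through $\|Q\|$ instead of $l$ is what puts $\|Q\|$ into $\theta_1$, the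
sharper of the two final quantities. -/
theorem norm_stage_le (h : IsPerturbedGramSchmidt A H Q R Er S F u l ρ κ) (i : Fin n) :
    ‖S i‖ ≤ 3 * ‖Q‖ * ‖H * S 0‖ := by
  have h1 := MGSHA.norm_stage_le h.step h.finish (i := i) i.2.le
  have h2 := mul_le_mul_of_nonneg_left h.norm_coef_le (norm_nonneg Q)
  have h3 := mul_le_mul_of_nonneg_right h.ρ_small (norm_nonneg (H * S 0))
  linarith [h.sum_stepErr_le]

theorem norm_strictUpper_mul_le (h : IsPerturbedGramSchmidt A H Q R Er S F u l ρ κ) :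
    ‖strictUpper (Qᵀ * A * Q) * R‖ ≤
      300 * (m * √(m : ℝ) * u * ‖H‖ ^ 2 * ‖Q‖ * ρ) * ‖H * S 0‖ := by
  have hu := h.u_nonneg
  have hρ := h.ρ_nonneg
  have hErΘ : ∀ i : Fin n,
      vnorm (Er i) ≤ 192 * (m * u) * (‖H‖ ^ 2 * ‖Q‖ * ρ * ‖H * S 0‖) := by
    intro i
    have hq := vnorm_nonneg (Q.col i)
    refine (h.coefErr i).trans ?_
    rw [h.norm_eq]
    calc 32 * (m * u) * ‖H‖ ^ 2 * vnorm (Q.col i) * ‖S i‖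
        ≤ 32 * (m * u) * ‖H‖ ^ 2 * (2 * ρ) * (3 * ‖Q‖ * ‖H * S 0‖) := by
          gcongr
          exacts [h.col i, h.norm_stage_le i]
      _ = _ := by ring
  have h1 := MGSHA.norm_strictUpper_mul_le h.step h.finish h.coef (by positivity) h.diag_le
    (by positivity) hErΘ
  rw [h.norm_eq] at h1
  set Θ := m * √(m : ℝ) * u * ‖H‖ ^ 2 * ‖Q‖ * ρ with hΘ
  have hΘ0 : 0 ≤ Θ := by positivity
  have h2 : 34 * Θ * ‖R‖ ≤ 34 * Θ * (2 * ‖H * S 0‖) := by gcongr; exact h.norm_coef_le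
  have h3 : ‖H‖ ^ 2 * ‖Q‖ * ∑ k, ‖F k‖ ≤ 26 * Θ * ‖H * S 0‖ := by
    calc _ ≤ ‖H‖ ^ 2 * ‖Q‖ * (26 * (m * √(m : ℝ) * u) * ρ * ‖H * S 0‖) := by
          gcongr; exact h.sum_stepErr_le
      _ = _ := by rw [hΘ]; ring
  have h4 : √(n : ℝ) * (192 * (m * u) * (‖H‖ ^ 2 * ‖Q‖ * ρ * ‖H * S 0‖)) ≤
      192 * Θ * ‖H * S 0‖ := by
    have h5 := sqrt_mul_le_mul_sqrt_mul h.le hu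
    calc _ = 192 * (√(n : ℝ) * (m * u)) * (‖H‖ ^ 2 * ‖Q‖ * ρ * ‖H * S 0‖) := by ring
      _ ≤ 192 * (m * √(m : ℝ) * u) * (‖H‖ ^ 2 * ‖Q‖ * ρ * ‖H * S 0‖) := by gcongr
      _ = _ := by rw [hΘ]; ring
  have h6 : 0 ≤ Θ * ‖H * S 0‖ := by positivity
  linarith

/-- $HS_0=HQR-H\sum_kF_k$, and the last term has norm at most $s/2$. This is where the product of
both condition numbers must be small. -/
theorem mul_vnorm_le (h : IsPerturbedGramSchmidt A H Q R Er S F u l ρ κ) {s K : ℝ} (hs : 0 ≤ s)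
    (hK0 : 0 ≤ K) (hsY : ∀ x, s * vnorm x ≤ vnorm ((H * S 0) *ᵥ x)) (hK : ‖H * S 0‖ ≤ K * s)
    (hsm : 1000000 * (m * √(m : ℝ) * u * κ * K) ≤ 1) (x : Fin n → ℝ) :
    s / 2 * vnorm x ≤ ‖H * Q‖ * vnorm (R *ᵥ x) := by
  have hu := h.u_nonneg
  have hρ := h.ρ_nonneg
  have hx := vnorm_nonneg x
  have h1 := hsY x
  have h2 : (H * S 0) *ᵥ x = (H * Q) *ᵥ (R *ᵥ x) - (H * ∑ k, F k) *ᵥ x := by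
    rw [stage_zero_eq h.step h.finish, Matrix.mul_sub, Matrix.sub_mulVec, Matrix.mulVec_mulVec,
      Matrix.mul_assoc]
  have h3 := vnorm_sub_le ((H * Q) *ᵥ (R *ᵥ x)) ((H * ∑ k, F k) *ᵥ x)
  have h4 := vnorm_mulVec_le (H * Q) (R *ᵥ x)
  have h5 : vnorm ((H * ∑ k, F k) *ᵥ x) ≤ s / 2 * vnorm x := by
    refine (vnorm_mulVec_le _ _).trans ?_
    gcongr
    have h6 : ‖∑ k, F k‖ ≤ 26 * (m * √(m : ℝ) * u) * ρ * (K * s) :=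
      (norm_sum_le _ _).trans (h.sum_stepErr_le.trans (by gcongr))
    calc ‖H * ∑ k, F k‖ ≤ ‖H‖ * ‖∑ k, F k‖ := Matrix.l2_opNorm_mul _ _
      _ ≤ ‖H‖ * (26 * (m * √(m : ℝ) * u) * ρ * (K * s)) := by gcongr
      _ = 26 * (m * √(m : ℝ) * u * (‖H‖ * ρ) * K) * s := by ring
      _ ≤ 26 * (m * √(m : ℝ) * u * κ * K) * s := by gcongr; exact h.norm_mul_ρ_le
      _ ≤ 1 / 2 * s := by gcongr; linarith
      _ = s / 2 := by ring
  rw [h2] at h1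
  linarith

theorem norm_strictUpper_le (h : IsPerturbedGramSchmidt A H Q R Er S F u l ρ κ) {s K : ℝ}
    (hs : 0 < s) (hV : 0 < ‖H * Q‖) (hK : ‖H * S 0‖ ≤ K * s)
    (hR : ∀ x, s / 2 * vnorm x ≤ ‖H * Q‖ * vnorm (R *ᵥ x)) :
    ‖strictUpper (Qᵀ * A * Q)‖ ≤
      600 * (m * √(m : ℝ) * u * ‖H‖ ^ 2 * ‖Q‖ * ρ * K * ‖H * Q‖) := by
  have hu := h.u_nonneg
  have hρ := h.ρ_nonneg
  have h1 := norm_le_of_norm_mul_le (s := s / (2 * ‖H * Q‖)) (by positivity)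
    h.norm_strictUpper_mul_le fun x => by
      rw [div_mul_eq_mul_div, div_le_iff₀ (by positivity)]
      linarith [hR x]
  refine h1.trans ?_
  rw [div_div_eq_mul_div, div_le_iff₀ hs]
  calc 300 * (m * √(m : ℝ) * u * ‖H‖ ^ 2 * ‖Q‖ * ρ) * ‖H * S 0‖ * (2 * ‖H * Q‖)
      ≤ 300 * (m * √(m : ℝ) * u * ‖H‖ ^ 2 * ‖Q‖ * ρ) * (K * s) * (2 * ‖H * Q‖) := by gcongr
    _ = _ := by ring

theorem transpose_gram (h : IsPerturbedGramSchmidt A H Q R Er S F u l ρ κ) :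
    (Qᵀ * A * Q)ᵀ = Qᵀ * A * Q := by
  rw [h.gram_eq, Matrix.transpose_mul, Matrix.transpose_transpose]

theorem norm_gram_sub_one_le (h : IsPerturbedGramSchmidt A H Q R Er S F u l ρ κ) {s K : ℝ}
    (hs : 0 < s) (hK1 : 1 ≤ K) (hsY : ∀ x, s * vnorm x ≤ vnorm ((H * S 0) *ᵥ x))
    (hK : ‖H * S 0‖ ≤ K * s) (hsm : 1000000 * (m * √(m : ℝ) * u * κ * K) ≤ 1) :
    ‖Q‖ ≤ 3 / 2 * l ∧
      ‖Qᵀ * A * Q - 1‖ ≤ 2000 * (m * √(m : ℝ) * u * ‖A‖ * ‖Q‖ * ρ * K) := by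
  have hu := h.u_nonneg
  have hρ := h.ρ_nonneg
  have hl := h.l_nonneg
  have hR := h.mul_vnorm_le hs.le (by linarith) hsY hK hsm
  have hV : 0 < ‖H * Q‖ := by
    rcases (norm_nonneg (H * Q)).eq_or_lt with h0 | h0
    · have h1 := hR (Pi.single ⟨0, h.pos⟩ 1)
      rw [← h0, vnorm_single, abs_one] at h1
      linarith
    · exact h0
  have hU := h.norm_strictUpper_le hs hV hK hR
  have hql := h.norm_le_mul Q
  have hΘ0 : 0 ≤ m * √(m : ℝ) * u * ‖H‖ ^ 2 * ‖Q‖ * ρ := by positivity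
  -- With $\|Q\|\le l\|HQ\|$ the estimate for the strictly upper part becomes a tiny multiple of
  -- $\|HQ\|^2$, which the next bound on $V$ absorbs into $\|Q^TAQ\|=\|HQ\|^2$.
  have hΘV : m * √(m : ℝ) * u * ‖H‖ ^ 2 * ‖Q‖ * ρ * K ≤ 1 / 1000000 * ‖H * Q‖ := by
    calc m * √(m : ℝ) * u * ‖H‖ ^ 2 * ‖Q‖ * ρ * K
        ≤ m * √(m : ℝ) * u * ‖H‖ ^ 2 * (l * ‖H * Q‖) * ρ * K := by gcongr
      _ = m * √(m : ℝ) * u * (‖H‖ ^ 2 * ρ * l) * K * ‖H * Q‖ := by ring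
      _ ≤ m * √(m : ℝ) * u * κ * K * ‖H * Q‖ := by gcongr; exact h.norm_sq_mul_le
      _ ≤ _ := by gcongr; linarith
  have hgram : ‖Qᵀ * A * Q‖ = ‖H * Q‖ ^ 2 := by rw [h.gram_eq, norm_transpose_mul_self]
  have hsym := h.transpose_gram
  have hD := h.diag_small
  have hD' := h.diag_le
  rw [h.norm_eq]
  clear hR hsY hsm hK
  set V := ‖H * Q‖
  set Θ := m * √(m : ℝ) * u * ‖H‖ ^ 2 * ‖Q‖ * ρ
  have hV32 : V ≤ 3 / 2 := by
    have h1 := MGSHA.norm_gram_sub_one_le hsym (by norm_num) hD hU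
    have h3 := norm_add_le (Qᵀ * A * Q - 1) 1
    rw [sub_add_cancel, hgram] at h3
    have h4 := norm_one_le n
    have h5 : Θ * K * V ≤ 1 / 1000000 * V * V := by gcongr
    nlinarith
  constructor
  · refine hql.trans ?_
    rw [mul_comm]
    gcongr
  -- With $V\le3/2$ the constants add up to $34+2\cdot600\cdot\frac32=1834\le2000$.
  · have h1 := MGSHA.norm_gram_sub_one_le hsym (by positivity) hD' hU
    have h2 : Θ * K * V ≤ Θ * K * (3 / 2) := by gcongr
    have h3 : Θ ≤ Θ * K := le_mul_of_one_le_right hΘ0 hK1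
    linarith

end IsPerturbedGramSchmidt

/-! ### Singular values and norms -/

section SingularValues

variable {E F : Type*} [NormedAddCommGroup E] [InnerProductSpace ℝ E] [FiniteDimensional ℝ E]
  [NormedAddCommGroup F] [InnerProductSpace ℝ F] [FiniteDimensional ℝ F] (T : E →ₗ[ℝ] F)

/-- Expansion in an orthonormal eigenbasis of $T^*T$; both extremal inequalities for singular values
follow from it by monotonicity. -/
theorem norm_sq_eq_sum_singularValues (x : E) :
    ‖T x‖ ^ 2 = ∑ i : Fin (Module.finrank ℝ E), T.singularValues i ^ 2 *
      inner ℝ (T.isSymmetric_adjoint_comp_self.eigenvectorBasis rfl i) x ^ 2 := by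
  set b := T.isSymmetric_adjoint_comp_self.eigenvectorBasis rfl with hb
  have h1 : ‖T x‖ ^ 2 = inner ℝ x ((LinearMap.adjoint T ∘ₗ T) x) := by
    rw [LinearMap.comp_apply, LinearMap.adjoint_inner_right, real_inner_self_eq_norm_sq]
  rw [h1, ← b.sum_inner_mul_inner]
  refine Finset.sum_congr rfl fun i _ => ?_
  have h2 : inner ℝ (b i) ((LinearMap.adjoint T ∘ₗ T) x) =
      T.singularValues i ^ 2 * inner ℝ (b i) x := by
    rw [← T.isSymmetric_adjoint_comp_self (b i) x, hb,
      T.isSymmetric_adjoint_comp_self.apply_eigenvectorBasis, T.sq_singularValues_fin rfl]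
    simp [inner_smul_left]
  rw [h2, real_inner_comm]
  ring

theorem sum_inner_eigenvectorBasis_sq (x : E) :
    ∑ i : Fin (Module.finrank ℝ E),
      inner ℝ (T.isSymmetric_adjoint_comp_self.eigenvectorBasis rfl i) x ^ 2 = ‖x‖ ^ 2 := by
  rw [← real_inner_self_eq_norm_sq,
    ← (T.isSymmetric_adjoint_comp_self.eigenvectorBasis rfl).sum_inner_mul_inner]
  refine Finset.sum_congr rfl fun i _ => ?_
  rw [real_inner_comm, pow_two]

theorem norm_apply_le_singularValues (x : E) : ‖T x‖ ≤ T.singularValues 0 * ‖x‖ := by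
  refine le_of_sq_le_sq ?_ (mul_nonneg (T.singularValues_nonneg 0) (norm_nonneg x))
  rw [norm_sq_eq_sum_singularValues, mul_pow, ← sum_inner_eigenvectorBasis_sq T x, Finset.mul_sum]
  refine Finset.sum_le_sum fun i _ => ?_
  have h1 := T.singularValues_antitone (Nat.zero_le i)
  have h2 := T.singularValues_nonneg i
  gcongr

theorem singularValues_mul_norm_le (x : E) :
    T.singularValues (Module.finrank ℝ E - 1) * ‖x‖ ≤ ‖T x‖ := by
  refine le_of_sq_le_sq ?_ (norm_nonneg _)
  rw [norm_sq_eq_sum_singularValues, mul_pow, ← sum_inner_eigenvectorBasis_sq T x, Finset.mul_sum]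
  refine Finset.sum_le_sum fun i _ => ?_
  have h1 := T.singularValues_antitone (show (i : ℕ) ≤ Module.finrank ℝ E - 1 by omega)
  have h2 := T.singularValues_nonneg (Module.finrank ℝ E - 1)
  gcongr

end SingularValues

theorem norm_le_singularValues {m n : ℕ} (B : Matrix (Fin m) (Fin n) ℝ) :
    ‖B‖ ≤ (Matrix.toEuclideanLin B).singularValues 0 :=
  norm_le_of_vnorm_mulVec_le (LinearMap.singularValues_nonneg _ _) fun x =>
    norm_apply_le_singularValues (Matrix.toEuclideanLin B) (WithLp.toLp 2 x)

theorem singularValues_mul_vnorm_le {m n : ℕ} (B : Matrix (Fin m) (Fin n) ℝ) (x : Fin n → ℝ) :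
    (Matrix.toEuclideanLin B).singularValues (n - 1) * vnorm x ≤ vnorm (B *ᵥ x) := by
  have h := singularValues_mul_norm_le (Matrix.toEuclideanLin B) (WithLp.toLp 2 x)
  rw [finrank_euclideanSpace_fin] at h
  exact h

theorem singularValues_pos {m n : ℕ} (hn : 0 < n) {B : Matrix (Fin m) (Fin n) ℝ}
    (hB : Function.Injective B.mulVec) : 0 < (Matrix.toEuclideanLin B).singularValues (n - 1) := by
  have hinj : Function.Injective (Matrix.toEuclideanLin B) := by
    intro x y hxy
    have h1 : B.mulVec x.ofLp = B.mulVec y.ofLp := congrArg WithLp.ofLp hxy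
    exact WithLp.ofLp_injective 2 (hB h1)
  refine (LinearMap.injective_iff_forall_lt_finrank_singularValues_pos _).mp hinj _ ?_
  rw [finrank_euclideanSpace_fin]
  omega

theorem norm_le_cond_mul {m n : ℕ} (hn : 0 < n) {B : Matrix (Fin m) (Fin n) ℝ}
    (hB : Function.Injective B.mulVec) :
    ‖B‖ ≤ cond B * (Matrix.toEuclideanLin B).singularValues (n - 1) := by
  rw [cond, div_mul_cancel₀ _ (singularValues_pos hn hB).ne']
  exact norm_le_singularValues B

/-! ### The square root of a positive definite matrix -/

section Sqrt

variable {m : ℕ} {A : Matrix (Fin m) (Fin m) ℝ}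

theorem sqrt_mul_sqrt (hA : A.PosDef) : CFC.sqrt A * CFC.sqrt A = A :=
  CFC.sqrt_mul_sqrt_self A (Matrix.nonneg_iff_posSemidef.mpr hA.posSemidef)

theorem transpose_sqrt (A : Matrix (Fin m) (Fin m) ℝ) : (CFC.sqrt A)ᵀ = CFC.sqrt A := by
  simpa using (Matrix.nonneg_iff_posSemidef.mp (CFC.sqrt_nonneg A)).1.eq

theorem anorm_eq (hA : A.PosDef) (x : Fin m → ℝ) : anorm A x = vnorm (CFC.sqrt A *ᵥ x) := by
  rw [anorm, ← Real.sqrt_sq (vnorm_nonneg (CFC.sqrt A *ᵥ x)), vnorm_sq]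
  congr 1
  conv_lhs => rw [← sqrt_mul_sqrt hA, ← Matrix.mulVec_mulVec, dotProduct_mulVec_transpose,
    transpose_sqrt]

theorem isUnit_sqrt (hA : A.PosDef) : IsUnit (CFC.sqrt A) := by
  have h := hA.isUnit
  rw [← sqrt_mul_sqrt hA] at h
  exact ((Commute.refl (CFC.sqrt A)).isUnit_mul_iff.mp h).1

/-- The reciprocal square root of the smallest singular value. -/
noncomputable def invSqrtMin (A : Matrix (Fin m) (Fin m) ℝ) : ℝ :=
  (√((Matrix.toEuclideanLin A).singularValues (m - 1)))⁻¹

/-- $\|A^{-1/2}\|^2=\|A^{-1}\|\le1/\sigma_{\min}(A)$, by symmetry of the root. -/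
theorem vnorm_le_invSqrtMin_mul (hm : 0 < m) (hA : A.PosDef) (v : Fin m → ℝ) :
    vnorm v ≤ invSqrtMin A * vnorm (CFC.sqrt A *ᵥ v) := by
  have hinj : Function.Injective A.mulVec := Matrix.mulVec_injective_iff_isUnit.mpr hA.isUnit
  have hs := singularValues_pos hm hinj
  have hunit := (Matrix.isUnit_iff_isUnit_det _).mp (isUnit_sqrt hA)
  set s := (Matrix.toEuclideanLin A).singularValues (m - 1) with hsdef
  have h1 : ‖A⁻¹‖ ≤ 1 / s := norm_le_of_norm_mul_le hs
    (by rw [Matrix.nonsing_inv_mul _ ((Matrix.isUnit_iff_isUnit_det _).mp hA.isUnit)]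
        exact norm_one_le m)
    (singularValues_mul_vnorm_le A)
  have h2 : ‖(CFC.sqrt A)⁻¹‖ ^ 2 = ‖A⁻¹‖ := by
    rw [← norm_transpose_mul_self, Matrix.transpose_nonsing_inv, transpose_sqrt,
      ← Matrix.mul_inv_rev, sqrt_mul_sqrt hA]
  have h3 : ‖(CFC.sqrt A)⁻¹‖ ≤ invSqrtMin A := by
    rw [invSqrtMin, ← Real.sqrt_inv, ← hsdef]
    refine Real.le_sqrt_of_sq_le ?_
    rw [h2]
    simpa using h1
  have h4 : v = (CFC.sqrt A)⁻¹ *ᵥ (CFC.sqrt A *ᵥ v) := by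
    rw [Matrix.mulVec_mulVec, Matrix.nonsing_inv_mul _ hunit, Matrix.one_mulVec]
  have h5 := vnorm_nonneg (CFC.sqrt A *ᵥ v)
  calc vnorm v = vnorm ((CFC.sqrt A)⁻¹ *ᵥ (CFC.sqrt A *ᵥ v)) := by rw [← h4]
    _ ≤ ‖(CFC.sqrt A)⁻¹‖ * vnorm (CFC.sqrt A *ᵥ v) := vnorm_mulVec_le _ _
    _ ≤ _ := by gcongr

theorem norm_mul_invSqrtMin_sq_le (hm : 0 < m) (hA : A.PosDef) :
    ‖A‖ * invSqrtMin A ^ 2 ≤ cond A := by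
  have hinj : Function.Injective A.mulVec := Matrix.mulVec_injective_iff_isUnit.mpr hA.isUnit
  have hs := singularValues_pos hm hinj
  rw [invSqrtMin, inv_pow, Real.sq_sqrt hs.le, cond, ← div_eq_mul_inv]
  exact div_le_div_of_nonneg_right (norm_le_singularValues A) hs.le

end Sqrt

/-! ### The largest ratio of the norms -/

section MaxRatio

variable {m n : ℕ} {A : Matrix (Fin m) (Fin m) ℝ} (c : Computed m n)

theorem Computed.maxRatio_nonneg : 0 ≤ c.maxRatio A :=
  Real.iSup_nonneg fun _ => div_nonneg (vnorm_nonneg _) (Real.sqrt_nonneg _)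

theorem Computed.maxRatio_le (hm : 0 < m) (hA : A.PosDef) : c.maxRatio A ≤ invSqrtMin A := by
  have hl : 0 ≤ invSqrtMin A := inv_nonneg.mpr (Real.sqrt_nonneg _)
  refine Real.iSup_le (fun e => ?_) hl
  refine div_le_of_le_mul₀ (Real.sqrt_nonneg _) hl ?_
  rw [anorm_eq hA]
  exact vnorm_le_invSqrtMin_mul hm hA _

theorem Computed.vnorm_le_maxRatio_mul (hm : 0 < m) (hA : A.PosDef) {i j : Fin n} (hij : i ≤ j) :
    vnorm (c.z j i) ≤ c.maxRatio A * vnorm (CFC.sqrt A *ᵥ c.z j i) := by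
  have h1 := vnorm_le_invSqrtMin_mul hm hA (c.z j i)
  -- A zero denominator makes the quotient $0$ by convention, but then the vector itself vanishes
  -- and the inequality is trivial.
  rcases (vnorm_nonneg (CFC.sqrt A *ᵥ c.z j i)).eq_or_lt with h | h
  · rw [← h, mul_zero] at h1 ⊢
    exact h1
  · rw [← div_le_iff₀ h, ← anorm_eq hA]
    exact le_ciSup (f := fun e : {e : Fin n × Fin n // e.1 ≤ e.2} =>
      vnorm (c.z e.1.2 e.1.1) / anorm A (c.z e.1.2 e.1.1)) (Set.finite_range _).bddAbove
      ⟨(i, j), hij⟩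

end MaxRatio

/-! ### The local errors of a run -/

section Run

variable {m n : ℕ} {u : ℝ} {τ σ : SumTree m} {A : Matrix (Fin m) (Fin m) ℝ}
  {Z : Matrix (Fin m) (Fin n) ℝ} {c : Computed m n}

theorem abs_dotProduct_mulVec_le (A : Matrix (Fin m) (Fin m) ℝ) (x y : Fin m → ℝ) :
    |x ⬝ᵥ A *ᵥ y| ≤ ‖A‖ * (vnorm x * vnorm y) := by
  refine (abs_dotProduct_le _ _).trans ?_
  have := mul_le_mul_of_nonneg_left (vnorm_mulVec_le A y) (vnorm_nonneg x)
  linarith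

theorem IsRun.abs_s_sub_le (hc : IsRun u τ σ A Z c) (hu : 0 ≤ u) (hτ : τ.Complete)
    (hσ : σ.Complete) (hμ : 1000000 * (m * u) ≤ 1) (j : Fin n) :
    |c.s j - c.z j j ⬝ᵥ A *ᵥ c.z j j| ≤ 7 * (m * u) * (‖A‖ * vnorm (c.z j j) ^ 2) := by
  have he := accErr_le hu hτ.pos (by linarith)
  have he0 := accErr_nonneg hu m
  have h1 := (hc.radicand j).abs_sub_le hu hτ
  have h2 := hc.vnorm_x_sub_le hu hσ j
  have h3 := hc.vnorm_x_le hu hσ j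
  have h4 := abs_dotProduct_le (c.z j j) (c.x j - A *ᵥ c.z j j)
  have hz := vnorm_nonneg (c.z j j)
  have hAn := norm_nonneg A
  set e := accErr m u
  set z := vnorm (c.z j j)
  have h5 : |c.s j - c.z j j ⬝ᵥ c.x j| ≤ e * (z * ((1 + e) * (‖A‖ * z))) :=
    h1.trans (by gcongr)
  have h6 : |c.z j j ⬝ᵥ (c.x j - A *ᵥ c.z j j)| ≤ z * (e * (‖A‖ * z)) :=
    h4.trans (by gcongr)
  have h7 : c.s j - c.z j j ⬝ᵥ A *ᵥ c.z j j =
      (c.s j - c.z j j ⬝ᵥ c.x j) + c.z j j ⬝ᵥ (c.x j - A *ᵥ c.z j j) := by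
    rw [dotProduct_sub]; ring
  rw [h7]
  refine (abs_add_le _ _).trans ((add_le_add h5 h6).trans ?_)
  have h8 : e * (z * ((1 + e) * (‖A‖ * z))) + z * (e * (‖A‖ * z)) =
      (e * (2 + e)) * (‖A‖ * z ^ 2) := by ring
  rw [h8]
  refine mul_le_mul_of_nonneg_right ?_ (by positivity)
  nlinarith

theorem IsRun.abs_diag_sq_sub_le (hc : IsRun u τ σ A Z c) (hu : 0 ≤ u) (hu1 : 1000000 * u ≤ 1)
    (j : Fin n) : |c.r j j ^ 2 - c.s j| ≤ 3 * u * c.s j := by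
  obtain ⟨δ, hδ, h⟩ := hc.diag j
  have hs := hc.radicand_pos j
  have h1 : c.r j j ^ 2 - c.s j = c.s j * (δ * (2 + δ)) := by
    rw [h, mul_pow, Real.sq_sqrt hs.le]; ring
  rw [h1, abs_mul, abs_mul, abs_of_pos hs, mul_comm]
  have h2 : |2 + δ| ≤ 3 := by
    have := abs_le.mp hδ
    rw [abs_le]
    constructor <;> linarith
  have : |δ| * |2 + δ| ≤ u * 3 := by gcongr
  nlinarith

theorem IsRun.vnorm_q_sub_le (hc : IsRun u τ σ A Z c) (hu : 0 ≤ u) (hu1 : 1000000 * u ≤ 1)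
    (j : Fin n) : vnorm (c.r j j • c.q j - c.z j j) ≤ u * vnorm (c.z j j) :=
  (hc.scale_q j).vnorm_sub_le hu (hc.diag_pos (by linarith) j)

theorem IsRun.diag_mul_vnorm_q_le (hc : IsRun u τ σ A Z c) (hu : 0 ≤ u)
    (hu1 : 1000000 * u ≤ 1) (j : Fin n) :
    c.r j j * vnorm (c.q j) ≤ (1 + u) * vnorm (c.z j j) := by
  have hr := hc.diag_pos (by linarith) j
  have h1 := hc.vnorm_q_sub_le hu hu1 j
  have h2 := vnorm_add_le (c.r j j • c.q j - c.z j j) (c.z j j)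
  rw [sub_add_cancel, vnorm_smul, abs_of_pos hr] at h2
  linarith

theorem IsRun.abs_one_sub_le (hc : IsRun u τ σ A Z c) (hA : A.IsHermitian) (hu : 0 ≤ u)
    (hτ : τ.Complete) (hσ : σ.Complete) (hμ : 1000000 * (m * u) ≤ 1) (j : Fin n) :
    |1 - c.q j ⬝ᵥ A *ᵥ c.q j| ≤ 17 * (m * u) * ‖A‖ * vnorm (c.q j) ^ 2 := by
  have hm1 : (1 : ℝ) ≤ m := by exact_mod_cast hτ.pos
  have huμ : u ≤ m * u := le_mul_of_one_le_left hu hm1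
  have hu1 : 1000000 * u ≤ 1 := by linarith
  have hr := hc.diag_pos (by linarith) j
  have h1 := hc.abs_s_sub_le hu hτ hσ hμ j
  have h2 := hc.abs_diag_sq_sub_le hu hu1 j
  have h3 := hc.vnorm_q_sub_le hu hu1 j
  have h4 := hc.vnorm_z_le hu (by linarith) j
  have h5 := (abs_le.mp (abs_dotProduct_mulVec_le A (c.z j j) (c.z j j))).2
  have hz := vnorm_nonneg (c.z j j)
  have hq := vnorm_nonneg (c.q j)
  have hf := vnorm_nonneg (c.r j j • c.q j - c.z j j)
  have hAn := norm_nonneg A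
  have hdec : c.r j j ^ 2 * (c.q j ⬝ᵥ A *ᵥ c.q j) - c.z j j ⬝ᵥ A *ᵥ c.z j j =
      (c.r j j • c.q j - c.z j j) ⬝ᵥ A *ᵥ (c.r j j • c.q j - c.z j j) +
        2 * ((c.r j j • c.q j - c.z j j) ⬝ᵥ A *ᵥ c.z j j) := by
    have hsym : c.z j j ⬝ᵥ A *ᵥ c.q j = c.q j ⬝ᵥ A *ᵥ c.z j j := by
      rw [dotProduct_mulVec_transpose, dotProduct_comm]
      congr 2
    simp only [Matrix.mulVec_sub, Matrix.mulVec_smul, sub_dotProduct, dotProduct_sub,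
      smul_dotProduct, dotProduct_smul, smul_eq_mul, hsym]
    ring
  have h6 := abs_dotProduct_mulVec_le A (c.r j j • c.q j - c.z j j)
    (c.r j j • c.q j - c.z j j)
  have h7 := abs_dotProduct_mulVec_le A (c.r j j • c.q j - c.z j j) (c.z j j)
  set f := vnorm (c.r j j • c.q j - c.z j j)
  set z := vnorm (c.z j j) with hzdef
  set a := c.q j ⬝ᵥ A *ᵥ c.q j
  set b := c.z j j ⬝ᵥ A *ᵥ c.z j j
  have h8 : |c.r j j ^ 2 * a - b| ≤ 3 * u * (‖A‖ * z ^ 2) := by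
    rw [hdec]
    have h9 : ‖A‖ * (f * f) ≤ ‖A‖ * ((u * z) * (u * z)) := by gcongr
    have h10 : ‖A‖ * (f * z) ≤ ‖A‖ * ((u * z) * z) := by gcongr
    have h11 : ‖A‖ * ((u * z) * (u * z)) ≤ u * (‖A‖ * z ^ 2) := by
      calc ‖A‖ * ((u * z) * (u * z)) = u * (u * (‖A‖ * z ^ 2)) := by ring
        _ ≤ u * (1 * (‖A‖ * z ^ 2)) := by gcongr; linarith
        _ = _ := by ring
    refine (abs_add_le _ _).trans ?_
    rw [abs_mul, abs_two]
    linarith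
  set X := ‖A‖ * z ^ 2 with hX
  have hX0 : 0 ≤ X := by positivity
  have h5' : b ≤ X := by rw [hX, pow_two]; exact h5
  have hs2 : c.s j ≤ 2 * X := by
    have := (abs_le.mp h1).2
    nlinarith
  have h9 : c.r j j ^ 2 * |1 - a| ≤ 16 * (m * u) * X := by
    rw [← abs_of_pos (pow_pos hr 2), ← abs_mul]
    -- Rounded root, rounded radicand and rounded division contribute $6u$, $7mu$ and $3u$, in total
    -- at most $16mu$.
    have h10 : c.r j j ^ 2 * (1 - a) =
        (c.r j j ^ 2 - c.s j) + ((c.s j - b) - (c.r j j ^ 2 * a - b)) := by ring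
    rw [h10]
    have h11 := abs_add_le (c.r j j ^ 2 - c.s j) ((c.s j - b) - (c.r j j ^ 2 * a - b))
    have h12 := abs_sub (c.s j - b) (c.r j j ^ 2 * a - b)
    have h13 : 3 * u * c.s j ≤ 3 * u * (2 * X) := by gcongr
    have h14 : u * X ≤ m * u * X := by gcongr
    linarith
  have h10 : z ^ 2 ≤ 17 / 16 * (c.r j j ^ 2 * vnorm (c.q j) ^ 2) := by
    have h11 : 999 / 1000 * z ≤ c.r j j * vnorm (c.q j) := by nlinarith
    have h12 := pow_le_pow_left₀ (by positivity) h11 2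
    nlinarith [sq_nonneg z]
  have h11 : c.r j j ^ 2 * |1 - a| ≤
      c.r j j ^ 2 * (17 * (m * u) * ‖A‖ * vnorm (c.q j) ^ 2) := by
    refine h9.trans ?_
    calc 16 * (m * u) * X
        ≤ 16 * (m * u) * (‖A‖ * (17 / 16 * (c.r j j ^ 2 * vnorm (c.q j) ^ 2))) := by
          rw [hX]; gcongr
      _ = _ := by ring
  exact le_of_mul_le_mul_left h11 (by positivity)

/-- The computed $r_{jj}$ is close to $\|z_j\|_A$, so $\|q_j\|$ is close to $\|z_j\|/\|z_j\|_A$; the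
factor $2$ is generous. -/
theorem IsRun.vnorm_q_le (hc : IsRun u τ σ A Z c) (hA : A.PosDef) (hu : 0 ≤ u)
    (hτ : τ.Complete) (hσ : σ.Complete) (hμ : 1000000 * (m * u) ≤ 1)
    (hμρ : 1000000 * (m * u * (‖A‖ * c.maxRatio A ^ 2)) ≤ 1) (j : Fin n) :
    vnorm (c.q j) ≤ 2 * c.maxRatio A := by
  have hm1 : (1 : ℝ) ≤ m := by exact_mod_cast hτ.pos
  have huμ : u ≤ m * u := le_mul_of_one_le_left hu hm1
  have hu1 : 1000000 * u ≤ 1 := by linarith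
  have hr := hc.diag_pos (by linarith) j
  have h1 := hc.abs_s_sub_le hu hτ hσ hμ j
  have h2 := hc.abs_diag_sq_sub_le hu hu1 j
  have h3 := hc.diag_mul_vnorm_q_le hu hu1 j
  have h4 := c.vnorm_le_maxRatio_mul hτ.pos hA (le_refl j)
  have hρ := c.maxRatio_nonneg (A := A)
  have hAn := norm_nonneg A
  have hz := vnorm_nonneg (c.z j j)
  have hq := vnorm_nonneg (c.q j)
  have hs := hc.radicand_pos j
  have h5 : c.z j j ⬝ᵥ A *ᵥ c.z j j = vnorm (CFC.sqrt A *ᵥ c.z j j) ^ 2 := by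
    rw [vnorm_sq]
    conv_lhs => rw [← sqrt_mul_sqrt hA, ← Matrix.mulVec_mulVec, dotProduct_mulVec_transpose,
      transpose_sqrt]
  rw [h5] at h1
  have hy := vnorm_nonneg (CFC.sqrt A *ᵥ c.z j j)
  set y := vnorm (CFC.sqrt A *ᵥ c.z j j)
  set ρ := c.maxRatio A
  have h6 := pow_le_pow_left₀ hz h4 2
  have h7 : 7 * (m * u) * (‖A‖ * vnorm (c.z j j) ^ 2) ≤ 1 / 1000 * y ^ 2 := by
    calc 7 * (m * u) * (‖A‖ * vnorm (c.z j j) ^ 2)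
        ≤ 7 * (m * u) * (‖A‖ * (ρ * y) ^ 2) := by gcongr
      _ = 7 * (m * u * (‖A‖ * ρ ^ 2)) * y ^ 2 := by ring
      _ ≤ 1 / 1000 * y ^ 2 := by gcongr; linarith
  have h8 := (abs_le.mp h1).1
  have h9 := (abs_le.mp h2).1
  have h10 : 3 * u * c.s j ≤ 1 / 1000 * c.s j := by gcongr; linarith
  have h11 : y ^ 2 ≤ (2 * c.r j j / (1 + u) / 1) ^ 2 := by
    have : (1 + u) ^ 2 * y ^ 2 ≤ (2 * c.r j j) ^ 2 := by
      have h12 : (1 + u) ^ 2 ≤ 2 := by nlinarith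
      have h13 : (1 + u) ^ 2 * y ^ 2 ≤ 2 * y ^ 2 := by gcongr
      nlinarith
    rw [div_one, div_pow, le_div_iff₀ (by positivity)]
    linarith
  have h12 : (1 + u) * y ≤ 2 * c.r j j := by
    have h13 := le_of_sq_le_sq h11 (by positivity)
    rw [div_one, le_div_iff₀ (by positivity)] at h13
    linarith
  have h13 : c.r j j * vnorm (c.q j) ≤ c.r j j * (2 * ρ) := by
    calc c.r j j * vnorm (c.q j) ≤ (1 + u) * (ρ * y) := h3.trans (by gcongr)
      _ = ((1 + u) * y) * ρ := by ring
      _ ≤ (2 * c.r j j) * ρ := by gcongr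
      _ = _ := by ring
  exact le_of_mul_le_mul_left h13 hr

theorem IsRun.vnorm_p_sub_le_seven (hc : IsRun u τ σ A Z c) (hu : 0 ≤ u)
    (hσ : σ.Complete) (hμ : 1000000 * (m * u) ≤ 1) (j : Fin n) :
    vnorm (c.p j - A *ᵥ c.q j) ≤ 7 * (m * u) * (‖A‖ * vnorm (c.q j)) := by
  have hm1 : (1 : ℝ) ≤ m := by exact_mod_cast hσ.pos
  have huμ : u ≤ m * u := le_mul_of_one_le_left hu hm1
  have he := accErr_le hu hσ.pos (by linarith)
  have he0 := accErr_nonneg hu m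
  have hq := vnorm_nonneg (c.q j)
  have hAn := norm_nonneg A
  refine (hc.vnorm_p_sub_le hu (by linarith) hσ j).trans ?_
  gcongr
  rw [sub_le_iff_le_add, div_le_iff₀ (by linarith)]
  nlinarith

theorem FlAxpy.vnorm_sub_le {z q y : Fin m → ℝ} {r : ℝ} (hu : 0 ≤ u) (hu1 : u ≤ 1)
    (h : FlAxpy u z r q y) :
    vnorm (y - z + r • q) ≤ u * vnorm z + 3 * u * (|r| * vnorm q) := by
  have h1 : ∃ a b : Fin m → ℝ, (∀ k, |a k| ≤ u * |z k|) ∧ (∀ k, |b k| ≤ 3 * u * |(r • q) k|) ∧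
      y - z + r • q = a + b := by
    choose t ht hy using h
    choose δ hδ ht using ht
    choose ε hε hy using hy
    refine ⟨fun k => ε k * z k, fun k => -(δ k + ε k * (1 + δ k)) * (r • q) k, fun k => ?_,
      fun k => ?_, ?_⟩
    · rw [abs_mul]
      exact mul_le_mul_of_nonneg_right (hε k) (abs_nonneg _)
    · rw [abs_mul]
      refine mul_le_mul_of_nonneg_right ?_ (abs_nonneg _)
      rw [abs_neg]
      have h2 : |ε k * (1 + δ k)| ≤ u * 2 := by
        rw [abs_mul]
        have h3 : |1 + δ k| ≤ 2 := by
          have := abs_le.mp (hδ k)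
          rw [abs_le]; constructor <;> linarith
        gcongr
        exact hε k
      have := abs_add_le (δ k) (ε k * (1 + δ k))
      linarith [hδ k]
    · ext k
      simp only [Pi.add_apply, Pi.sub_apply, Pi.smul_apply, smul_eq_mul, hy, ht]
      ring
  obtain ⟨a, b, ha, hb, hab⟩ := h1
  rw [hab, ← vnorm_smul]
  exact (vnorm_add_le a b).trans
    (add_le_add (vnorm_le_mul hu ha) (vnorm_le_mul (by positivity) hb))

/-! ### A run as a perturbed modified Gram-Schmidt process -/

/-- The vectors after `i` orthogonalization steps; the columns before column `i` are finished and
replaced by zero. -/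
def Computed.stage (c : Computed m n) (i : ℕ) : Matrix (Fin m) (Fin n) ℝ :=
  Matrix.of fun k j => if i ≤ (j : ℕ) then c.z j i k else 0

/-- The upper triangular matrix of the computed coefficients. -/
def Computed.coef (c : Computed m n) : Matrix (Fin n) (Fin n) ℝ :=
  Matrix.of fun i j => if i ≤ j then c.r i j else 0

/-- The rounding errors of the update in step `i`. -/
def Computed.updateErr (c : Computed m n) (i : Fin n) : Matrix (Fin m) (Fin n) ℝ :=
  c.stage (i + 1) - c.stage i + Matrix.vecMulVec (c.Q.col i) (c.coef i)

/-- The errors of the coefficients. -/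
def Computed.coefErr (A : Matrix (Fin m) (Fin m) ℝ) (c : Computed m n) :
    Matrix (Fin n) (Fin n) ℝ :=
  Matrix.of fun i j => c.coef i j - (c.Qᵀ * A * c.stage i) i j

theorem Computed.col_Q (c : Computed m n) (j : Fin n) : c.Q.col j = c.q j := rfl

theorem Computed.stage_succ (c : Computed m n) (i : Fin n) :
    c.stage (i + 1) =
      c.stage i - Matrix.vecMulVec (c.Q.col i) (c.coef i) + c.updateErr i := by
  rw [Computed.updateErr]; abel

theorem Computed.stage_self (c : Computed m n) : c.stage n = 0 := by
  ext k j
  have := j.2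
  simp [Computed.stage]

theorem IsRun.stage_zero (hc : IsRun u τ σ A Z c) : c.stage 0 = Z := by
  ext k j
  simp [Computed.stage, hc.init]

theorem Computed.col_stage (c : Computed m n) (i : ℕ) (j : Fin n) :
    (c.stage i).col j = if i ≤ (j : ℕ) then c.z j i else 0 := by
  ext k
  by_cases h : i ≤ (j : ℕ) <;> simp [Computed.stage, h]

theorem Computed.coef_eq (c : Computed m n) (A : Matrix (Fin m) (Fin m) ℝ) (i j : Fin n) :
    c.coef i j = (c.Qᵀ * A * c.stage i) i j + c.coefErr A i j := by
  simp [Computed.coefErr]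

theorem transpose_mul_mul_apply {l k : ℕ} (B : Matrix (Fin m) (Fin l) ℝ)
    (A : Matrix (Fin m) (Fin m) ℝ) (C : Matrix (Fin m) (Fin k) ℝ) (i : Fin l) (j : Fin k) :
    (Bᵀ * A * C) i j = B.col i ⬝ᵥ A *ᵥ C.col j := by
  rw [Matrix.mul_assoc, Matrix.mul_apply]
  rfl

theorem IsRun.abs_coefErr_diag_le (hc : IsRun u τ σ A Z c) (hA : A.IsHermitian) (hu : 0 ≤ u)
    (hτ : τ.Complete) (hσ : σ.Complete) (hμ : 1000000 * (m * u) ≤ 1) (i : Fin n) :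
    |c.coefErr A i i| ≤ 19 * (m * u) * ‖A‖ * vnorm (c.q i) * ‖c.stage i‖ := by
  have hm1 : (1 : ℝ) ≤ m := by exact_mod_cast hτ.pos
  have huμ : u ≤ m * u := le_mul_of_one_le_left hu hm1
  have hu1 : 1000000 * u ≤ 1 := by linarith
  have hr := hc.diag_pos (by linarith) i
  have h1 := hc.abs_one_sub_le hA hu hτ hσ hμ i
  have h2 := hc.vnorm_q_sub_le hu hu1 i
  have h3 := hc.diag_mul_vnorm_q_le hu hu1 i
  have hz := vnorm_nonneg (c.z i i)
  have hq := vnorm_nonneg (c.q i)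
  have hAn := norm_nonneg A
  have hcol : vnorm (c.z i i) ≤ ‖c.stage i‖ := by
    have := vnorm_col_le (c.stage i) i
    rwa [c.col_stage, if_pos le_rfl] at this
  have h4 : c.coefErr A i i =
      c.r i i * (1 - c.q i ⬝ᵥ A *ᵥ c.q i) + c.q i ⬝ᵥ A *ᵥ (c.r i i • c.q i - c.z i i) := by
    have h5 : c.coef i i = c.r i i := by simp [Computed.coef]
    have h6 := c.coef_eq A i i
    rw [transpose_mul_mul_apply, c.col_stage, if_pos le_rfl, c.col_Q, h5] at h6
    rw [Matrix.mulVec_sub, Matrix.mulVec_smul, dotProduct_sub, dotProduct_smul, smul_eq_mul]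
    linarith
  have h5 := abs_dotProduct_mulVec_le A (c.q i) (c.r i i • c.q i - c.z i i)
  rw [h4]
  refine (abs_add_le _ _).trans ?_
  rw [abs_mul, abs_of_pos hr]
  set z := vnorm (c.z i i)
  set q := vnorm (c.q i)
  have h6 : c.r i i * |1 - c.q i ⬝ᵥ A *ᵥ c.q i| ≤ 18 * (m * u) * ‖A‖ * q * z := by
    calc c.r i i * |1 - c.q i ⬝ᵥ A *ᵥ c.q i|
        ≤ c.r i i * (17 * (m * u) * ‖A‖ * q ^ 2) := by gcongr
      _ = 17 * (m * u) * ‖A‖ * q * (c.r i i * q) := by ring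
      _ ≤ 17 * (m * u) * ‖A‖ * q * ((1 + u) * z) := by gcongr
      _ = 17 * (1 + u) * ((m * u) * ‖A‖ * q * z) := by ring
      _ ≤ 18 * ((m * u) * ‖A‖ * q * z) := by gcongr; linarith
      _ = _ := by ring
  have h7 : ‖A‖ * (q * vnorm (c.r i i • c.q i - c.z i i)) ≤ (m * u) * ‖A‖ * q * z := by
    calc _ ≤ ‖A‖ * (q * (u * z)) := by gcongr
      _ = u * ‖A‖ * q * z := by ring
      _ ≤ _ := by gcongr
  have h8 : 19 * (m * u) * ‖A‖ * q * z ≤ 19 * (m * u) * ‖A‖ * q * ‖c.stage i‖ := by gcongr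
  linarith

/-- All coefficients in row $i$ right of the diagonal use the same $p_i$ and the same order, so
together they are one computed product $B^Tp_i$. The constant is $6+7+19$: this product, the error
of $p_i$ and the diagonal entry. -/
theorem IsRun.vnorm_coefErr_le (hc : IsRun u τ σ A Z c) (hA : A.IsHermitian) (hu : 0 ≤ u)
    (hτ : τ.Complete) (hσ : σ.Complete) (hμ : 1000000 * (m * u) ≤ 1) (i : Fin n) :
    vnorm (c.coefErr A i) ≤ 32 * (m * u) * ‖A‖ * vnorm (c.q i) * ‖c.stage i‖ := by
  have he := accErr_le hu hτ.pos (by linarith)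
  have he0 := accErr_nonneg hu m
  have hdiag := hc.abs_coefErr_diag_le hA hu hτ hσ hμ i
  have hp := hc.vnorm_p_sub_le_seven hu hσ hμ i
  have hAn := norm_nonneg A
  have hq := vnorm_nonneg (c.q i)
  have hpn : vnorm (c.p i) ≤ 2 * (‖A‖ * vnorm (c.q i)) := by
    have h1 := vnorm_add_le (c.p i - A *ᵥ c.q i) (A *ᵥ c.q i)
    rw [sub_add_cancel] at h1
    have h2 : 7 * (m * u) * (‖A‖ * vnorm (c.q i)) ≤ 1 * (‖A‖ * vnorm (c.q i)) := by
      gcongr; linarith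
    linarith [vnorm_mulVec_le A (c.q i)]
  -- the columns that are still to be orthogonalized
  set B : Matrix (Fin m) (Fin n) ℝ := Matrix.of fun k j => if i < j then c.stage i k j else 0
    with hB
  have hBn : ‖B‖ ≤ ‖c.stage i‖ := norm_mask_cols_le (fun j => i < j) (c.stage i)
  have hBcol : ∀ j, Bᵀ j = if i < j then c.z j i else 0 := by
    intro j
    ext k
    by_cases h : i < j
    · have h' : (i : ℕ) ≤ j := h.le
      have hs : c.stage i k j = c.z j i k := by
        simp only [Computed.stage, Matrix.of_apply, if_pos h']
      simp [hB, h, hs]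
    · simp [hB, h]
  set y : Fin n → ℝ := fun j => if i < j then c.r i j else 0 with hy
  have hdot : ∀ j, FlDot u τ (Bᵀ j) (c.p i) (y j) := by
    intro j
    rw [hBcol, hy]
    by_cases h : i < j
    · simpa [h] using (hc.offdiag i j h).comm
    · simpa [h] using flDot_zero hu τ (c.p i)
  have h1 := vnorm_flDot_sub_le hu hτ Bᵀ (c.p i) y hdot
  have h2 := vnorm_mulVec_le Bᵀ (c.p i - A *ᵥ c.q i)
  rw [norm_transpose] at h1 h2
  have hdec : c.coefErr A i =
      (y - Bᵀ *ᵥ c.p i) + (Bᵀ *ᵥ (c.p i - A *ᵥ c.q i) + Pi.single i (c.coefErr A i i)) := by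
    ext j
    simp only [Pi.add_apply, Pi.sub_apply, Matrix.mulVec_sub]
    have h3 : (Bᵀ *ᵥ A *ᵥ c.q i) j = (if i < j then c.z j i else 0) ⬝ᵥ A *ᵥ c.q i := by
      rw [← hBcol]; rfl
    have h4 := c.coef_eq A i j
    rw [transpose_mul_mul_apply, c.col_stage, c.col_Q] at h4
    rcases lt_trichotomy i j with h | h | h
    · have h' : (i : ℕ) ≤ j := h.le
      have h5 : c.coef i j = c.r i j := by simp [Computed.coef, h.le]
      rw [if_pos h', h5] at h4
      rw [h3, if_pos h, Pi.single_eq_of_ne h.ne', hy]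
      simp only [h, if_true]
      have h6 : c.z j i ⬝ᵥ A *ᵥ c.q i = c.q i ⬝ᵥ A *ᵥ c.z j i := by
        rw [dotProduct_mulVec_transpose, dotProduct_comm]
        congr 2
      rw [h6]
      linarith
    · subst h
      rw [h3]
      simp [hy]
    · have h' : ¬ (i : ℕ) ≤ j := not_le.mpr h
      have h5 : c.coef i j = 0 := by simp [Computed.coef, h]
      rw [if_neg h', h5] at h4
      rw [h3, if_neg h.not_gt, Pi.single_eq_of_ne h.ne, hy]
      simp only [h.not_gt, if_false]
      simp only [Matrix.mulVec_zero, dotProduct_zero, zero_dotProduct] at h4 ⊢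
      linarith
  have h3 := vnorm_add_le (y - Bᵀ *ᵥ c.p i)
    (Bᵀ *ᵥ (c.p i - A *ᵥ c.q i) + Pi.single i (c.coefErr A i i))
  have h4 := vnorm_add_le (Bᵀ *ᵥ (c.p i - A *ᵥ c.q i)) (Pi.single i (c.coefErr A i i))
  rw [vnorm_single] at h4
  rw [← hdec] at h3
  set N := ‖c.stage i‖
  have hN : 0 ≤ N := norm_nonneg _
  set q := vnorm (c.q i)
  have h5 : accErr m u * (‖B‖ * vnorm (c.p i)) ≤ 3 * (m * u) * (N * (2 * (‖A‖ * q))) := by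
    have := vnorm_nonneg (c.p i)
    gcongr
  have h6 : ‖B‖ * vnorm (c.p i - A *ᵥ c.q i) ≤ N * (7 * (m * u) * (‖A‖ * q)) := by
    have := vnorm_nonneg (c.p i - A *ᵥ c.q i)
    gcongr
  linarith

/-- Column by column: a rounded update costs $u\|z\|+3u|r|\|q\|$ with $\|z\|\le\rho N$, $|r|\le2N$
and $\|q\|\le2\rho$, which gives $13u\rho N$. -/
theorem IsRun.norm_updateErr_le (hc : IsRun u τ σ A Z c) (hA : A.PosDef) (hu : 0 ≤ u)
    (hτ : τ.Complete) (hσ : σ.Complete) (hμ : 1000000 * (m * u) ≤ 1)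
    (hμρ : 1000000 * (m * u * (‖A‖ * invSqrtMin A ^ 2)) ≤ 1) (i : Fin n) :
    ‖c.updateErr i‖ ≤ 13 * u * c.maxRatio A * √(n : ℝ) * ‖CFC.sqrt A * c.stage i‖ := by
  have hm1 : (1 : ℝ) ≤ m := by exact_mod_cast hτ.pos
  have huμ : u ≤ m * u := le_mul_of_one_le_left hu hm1
  have hu1 : 1000000 * u ≤ 1 := by linarith
  have hρ := c.maxRatio_nonneg (A := A)
  have hl := c.maxRatio_le hτ.pos hA
  have hAn := norm_nonneg A
  have hμρ' : 1000000 * (m * u * (‖A‖ * c.maxRatio A ^ 2)) ≤ 1 := by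
    refine le_trans ?_ hμρ
    gcongr
  have hqρ := hc.vnorm_q_le hA hu hτ hσ hμ hμρ' i
  have hq := vnorm_nonneg (c.q i)
  have hEr := hc.vnorm_coefErr_le hA.1 hu hτ hσ hμ i
  have hD := hc.abs_one_sub_le hA.1 hu hτ hσ hμ i
  set N := ‖CFC.sqrt A * c.stage i‖ with hN
  have hN0 : 0 ≤ N := norm_nonneg _
  set ρ := c.maxRatio A
  set l := invSqrtMin A
  have hl0 : 0 ≤ l := hρ.trans hl
  have hSl : ‖c.stage i‖ ≤ l * N := by
    refine norm_le_of_vnorm_mulVec_le (by positivity) fun x => ?_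
    refine (vnorm_le_invSqrtMin_mul hτ.pos hA _).trans ?_
    rw [Matrix.mulVec_mulVec, mul_assoc]
    gcongr
    exact vnorm_mulVec_le _ _
  have hErN : vnorm (c.coefErr A i) ≤ 1 / 2 * N := by
    refine hEr.trans ?_
    calc 32 * (m * u) * ‖A‖ * vnorm (c.q i) * ‖c.stage i‖
        ≤ 32 * (m * u) * ‖A‖ * (2 * l) * (l * N) := by
          gcongr
          linarith
      _ = 64 * (m * u * (‖A‖ * l ^ 2)) * N := by ring
      _ ≤ 1 / 2 * N := by gcongr; linarith
  have hgram : c.q i ⬝ᵥ A *ᵥ c.q i = vnorm (CFC.sqrt A *ᵥ c.q i) ^ 2 := by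
    rw [vnorm_sq]
    conv_lhs => rw [← sqrt_mul_sqrt hA, ← Matrix.mulVec_mulVec, dotProduct_mulVec_transpose,
      transpose_sqrt]
  have hw : vnorm (CFC.sqrt A *ᵥ c.q i) ≤ 3 / 2 := by
    have h1 : 17 * (m * u) * ‖A‖ * vnorm (c.q i) ^ 2 ≤ 1 := by
      calc 17 * (m * u) * ‖A‖ * vnorm (c.q i) ^ 2
          ≤ 17 * (m * u) * ‖A‖ * (2 * ρ) ^ 2 := by gcongr
        _ = 68 * (m * u * (‖A‖ * ρ ^ 2)) := by ring
        _ ≤ 1 := by linarith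
    have h2 := (abs_le.mp (hD.trans h1)).1
    rw [hgram] at h2
    have h3 := vnorm_nonneg (CFC.sqrt A *ᵥ c.q i)
    nlinarith
  have hcolN : ∀ j, vnorm (CFC.sqrt A *ᵥ (c.stage i).col j) ≤ N := by
    intro j
    exact vnorm_col_le (CFC.sqrt A * c.stage i) j
  have hcoef : ∀ j, |c.coef i j| ≤ 2 * N := by
    intro j
    have h1 := abs_dotProduct_le (CFC.sqrt A *ᵥ c.q i) (CFC.sqrt A *ᵥ (c.stage i).col j)
    have h2 : c.coef i j = (CFC.sqrt A *ᵥ c.q i) ⬝ᵥ (CFC.sqrt A *ᵥ (c.stage i).col j) +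
        c.coefErr A i j := by
      rw [c.coef_eq A, transpose_mul_mul_apply, c.col_Q]
      conv_lhs => rw [← sqrt_mul_sqrt hA, ← Matrix.mulVec_mulVec, dotProduct_mulVec_transpose,
        transpose_sqrt, sqrt_mul_sqrt hA]
    have h3 := abs_le_vnorm (c.coefErr A i) j
    have h4 : vnorm (CFC.sqrt A *ᵥ c.q i) * vnorm (CFC.sqrt A *ᵥ (c.stage i).col j) ≤
        3 / 2 * N := by
      have := vnorm_nonneg (CFC.sqrt A *ᵥ (c.stage i).col j)
      gcongr
      exact hcolN j
    rw [h2]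
    have := abs_add_le ((CFC.sqrt A *ᵥ c.q i) ⬝ᵥ (CFC.sqrt A *ᵥ (c.stage i).col j))
      (c.coefErr A i j)
    linarith
  have hcol : ∀ j, vnorm ((c.updateErr i).col j) ≤ 13 * u * ρ * N := by
    intro j
    have h1 : (c.updateErr i).col j =
        (c.stage (i + 1)).col j - (c.stage i).col j + c.coef i j • c.q i := by
      ext k
      simp [Computed.updateErr, Matrix.vecMulVec_apply, mul_comm, Computed.Q]
    rw [h1, c.col_stage, c.col_stage]
    rcases lt_trichotomy i j with h | h | h
    · have h' : (i : ℕ) ≤ j := h.le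
      have h'' : (i : ℕ) + 1 ≤ j := h
      have h2 : c.coef i j = c.r i j := by simp [Computed.coef, h.le]
      have h3 := hcoef j
      have h4 := hcolN j
      rw [c.col_stage, if_pos h'] at h4
      rw [if_pos h', if_pos h'', h2]
      rw [h2] at h3
      have h5 := (hc.update i j h).vnorm_sub_le hu (by linarith)
      have h6 := c.vnorm_le_maxRatio_mul hτ.pos hA h.le
      refine h5.trans ?_
      calc u * vnorm (c.z j i) + 3 * u * (|c.r i j| * vnorm (c.q i))
          ≤ u * (ρ * N) + 3 * u * ((2 * N) * (2 * ρ)) := by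
            gcongr
            exact h6.trans (by gcongr)
        _ = 13 * u * ρ * N := by ring
    -- Column $i$ is finished in step $i$ and replaced by zero, so its error is that of the
    -- division, $r_{ii}q_i-z_i$.
    · subst h
      have h2 : c.coef i i = c.r i i := by simp [Computed.coef]
      have h4 := hcolN i
      rw [c.col_stage, if_pos le_rfl] at h4
      rw [if_pos le_rfl, if_neg (by omega), h2, zero_sub, neg_add_eq_sub]
      refine (hc.vnorm_q_sub_le hu hu1 i).trans ?_
      have h6 := c.vnorm_le_maxRatio_mul hτ.pos hA (le_refl i)
      have h7 : u * vnorm (c.z i i) ≤ u * (ρ * N) := by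
        gcongr
        exact h6.trans (by gcongr)
      have h8 : 0 ≤ u * (ρ * N) := by positivity
      linarith
    · have h' : ¬ (i : ℕ) ≤ j := not_le.mpr h
      have h'' : ¬ (i : ℕ) + 1 ≤ j := by omega
      have h2 : c.coef i j = 0 := by simp [Computed.coef, h]
      rw [if_neg h', if_neg h'', h2, sub_zero, zero_smul, add_zero, vnorm_zero]
      positivity
  have := norm_le_of_col_le (by positivity) hcol
  linarith

end Run

/-! ### Assembling the bounds -/

theorem rpow_three_halves {x : ℝ} (hx : 0 ≤ x) : x ^ (3 / 2 : ℝ) = x * √x := by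
  rw [Real.sqrt_eq_rpow, show (3 / 2 : ℝ) = 1 + 1 / 2 by norm_num,
    Real.rpow_add' hx (by norm_num), Real.rpow_one]

theorem one_le_cond {m n : ℕ} (hn : 0 < n) {B : Matrix (Fin m) (Fin n) ℝ}
    (hB : Function.Injective B.mulVec) : 1 ≤ cond B := by
  rw [cond, one_le_div (singularValues_pos hn hB)]
  exact LinearMap.singularValues_antitone _ (Nat.zero_le _)

theorem mulVec_injective_sqrt_mul {m n : ℕ} {A : Matrix (Fin m) (Fin m) ℝ}
    {Z : Matrix (Fin m) (Fin n) ℝ} (hA : A.PosDef) (hZ : LinearIndependent ℝ Zᵀ) :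
    Function.Injective (CFC.sqrt A * Z).mulVec := by
  have h1 : Function.Injective Z.mulVec := Matrix.mulVec_injective_iff.mpr hZ
  have h2 := Matrix.mulVec_injective_iff_isUnit.mpr (isUnit_sqrt hA)
  intro x y hxy
  rw [← Matrix.mulVec_mulVec, ← Matrix.mulVec_mulVec] at hxy
  exact h1 (h2 hxy)

/-- The loss of orthogonality in a run. -/
theorem IsRun.norm_gram_sub_one_le {m n : ℕ} {u : ℝ} {τ σ : SumTree m}
    {A : Matrix (Fin m) (Fin m) ℝ} {Z : Matrix (Fin m) (Fin n) ℝ} {c : Computed m n}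
    (hc : IsRun u τ σ A Z c) (hn : 0 < n) (hnm : n ≤ m) (hA : A.PosDef)
    (hZ : LinearIndependent ℝ Zᵀ) (hu : 0 ≤ u) (hτ : τ.Complete) (hσ : σ.Complete)
    (hsm : 1000000 * (m * √(m : ℝ) * u * cond A * cond (CFC.sqrt A * Z)) ≤ 1) :
    ‖c.Q‖ ≤ 3 / 2 * invSqrtMin A ∧
      ‖c.Qᵀ * A * c.Q - 1‖ ≤ 2000 * (m * √(m : ℝ) * u * ‖A‖ * ‖c.Q‖ * c.maxRatio A *
        cond (CFC.sqrt A * Z)) := by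
  have hm := hτ.pos
  have hm1 : (1 : ℝ) ≤ m := by exact_mod_cast hm
  have hY := mulVec_injective_sqrt_mul hA hZ
  have hK1 := one_le_cond hn hY
  have hκ1 := one_le_cond hm (Matrix.mulVec_injective_iff_isUnit.mpr hA.isUnit)
  have hκ := norm_mul_invSqrtMin_sq_le hm hA
  have hρ := c.maxRatio_nonneg (A := A)
  have hl := c.maxRatio_le hm hA
  set K := cond (CFC.sqrt A * Z)
  set κ := cond A
  have hμκ : m * u * κ ≤ m * √(m : ℝ) * u * κ * K := by
    have h1 : 1 ≤ √(m : ℝ) * K :=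
      one_le_mul_of_one_le_of_one_le (Real.one_le_sqrt.mpr hm1) hK1
    calc m * u * κ ≤ m * u * κ * (√(m : ℝ) * K) :=
          le_mul_of_one_le_right (by positivity) h1
      _ = _ := by ring
  have hμ0 : 0 ≤ m * u := by positivity
  have hμ : 1000000 * (m * u) ≤ 1 := by
    have : m * u ≤ m * u * κ := le_mul_of_one_le_right hμ0 hκ1
    linarith
  have hμl : 1000000 * (m * u * (‖A‖ * invSqrtMin A ^ 2)) ≤ 1 := by
    have : m * u * (‖A‖ * invSqrtMin A ^ 2) ≤ m * u * κ := by gcongr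
    linarith
  have hμρ : 1000000 * (m * u * (‖A‖ * c.maxRatio A ^ 2)) ≤ 1 := by
    refine le_trans ?_ hμl
    gcongr
  have hgram : ∀ i, (c.Qᵀ * A * c.Q) i i = c.q i ⬝ᵥ A *ᵥ c.q i := fun i =>
    transpose_mul_mul_apply _ _ _ _ _
  have hpert : IsPerturbedGramSchmidt A (CFC.sqrt A) c.Q c.coef (c.coefErr A) c.stage c.updateErr
      u (invSqrtMin A) (c.maxRatio A) κ :=
    { pos := hn
      le := hnm
      u_nonneg := hu
      symm := transpose_sqrt A
      sq := sqrt_mul_sqrt hA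
      l_nonneg := hρ.trans hl
      vnorm_le := vnorm_le_invSqrtMin_mul hm hA
      norm_mul_sq_le := hκ
      ρ_nonneg := hρ
      ρ_le := hl
      step := c.stage_succ
      finish := c.stage_self
      coef := c.coef_eq A
      diag := fun i => by rw [hgram]; exact hc.abs_one_sub_le hA.1 hu hτ hσ hμ i
      col := hc.vnorm_q_le hA hu hτ hσ hμ hμρ
      coefErr := hc.vnorm_coefErr_le hA.1 hu hτ hσ hμ
      stepErr := hc.norm_updateErr_le hA hu hτ hσ hμ hμl
      small := by
        exact (mul_le_mul_of_nonneg_left (le_mul_of_one_le_right (by positivity) hK1)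
          (by norm_num)).trans hsm }
  refine hpert.norm_gram_sub_one_le (singularValues_pos hn hY) hK1 ?_ ?_ hsm
  · rw [hc.stage_zero]
    exact singularValues_mul_vnorm_le _
  · rw [hc.stage_zero]
    exact norm_le_cond_mul hn hY

end MGSHA

theorem mainTheorem2 :
    (∀ (m n : ℕ) (A : Matrix (Fin m) (Fin m) ℝ) (Z : Matrix (Fin m) (Fin n) ℝ) (u : ℝ)
        (τ σ : MGSHA.SumTree m) (c : MGSHA.Computed m n),
        A.PosDef → 0 ≤ u → τ.Complete → σ.Complete → MGSHA.IsRun u τ σ A Z c →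
        ((m : ℝ) * √(m : ℝ) + m + 2) * u < 1 →
        ∀ i j : Fin n, i < j →
          |c.r i j - c.q i ⬝ᵥ A *ᵥ c.z j i| ≤
            MGSHA.gam u ((m : ℝ) * √(m : ℝ) + m + 2) * ‖A‖ *
              MGSHA.vnorm (c.q i) * MGSHA.vnorm (c.z j i)) ∧
    (∃ C₁ C₂ : ℝ, 0 < C₁ ∧ 0 < C₂ ∧
      ∀ (m n : ℕ) (A : Matrix (Fin m) (Fin m) ℝ) (Z : Matrix (Fin m) (Fin n) ℝ) (u : ℝ)
        (τ σ : MGSHA.SumTree m) (c : MGSHA.Computed m n),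
        0 < n → n ≤ m → A.PosDef → LinearIndependent ℝ Zᵀ → 0 ≤ u →
        τ.Complete → σ.Complete → MGSHA.IsRun u τ σ A Z c →
        C₂ * (m : ℝ) ^ (3 / 2 : ℝ) * u * MGSHA.cond A * MGSHA.cond (CFC.sqrt A * Z) < 1 →
        C₁ * (m : ℝ) ^ (3 / 2 : ℝ) * u * ‖A‖ * ‖c.Q‖ * c.maxRatio A *
            MGSHA.cond (CFC.sqrt A * Z) < 1 ∧
        ‖c.Qᵀ * A * c.Q - 1‖ ≤
          (C₁ * (m : ℝ) ^ (3 / 2 : ℝ) * u * ‖A‖ * ‖c.Q‖ * c.maxRatio A *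
              MGSHA.cond (CFC.sqrt A * Z)) /
            (1 - C₁ * (m : ℝ) ^ (3 / 2 : ℝ) * u * ‖A‖ * ‖c.Q‖ * c.maxRatio A *
              MGSHA.cond (CFC.sqrt A * Z)) ∧
        (C₁ * (m : ℝ) ^ (3 / 2 : ℝ) * u * ‖A‖ * ‖c.Q‖ * c.maxRatio A *
              MGSHA.cond (CFC.sqrt A * Z)) /
            (1 - C₁ * (m : ℝ) ^ (3 / 2 : ℝ) * u * ‖A‖ * ‖c.Q‖ * c.maxRatio A *
              MGSHA.cond (CFC.sqrt A * Z)) ≤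
          (C₂ * (m : ℝ) ^ (3 / 2 : ℝ) * u * MGSHA.cond A * MGSHA.cond (CFC.sqrt A * Z)) /
            (1 - C₂ * (m : ℝ) ^ (3 / 2 : ℝ) * u * MGSHA.cond A * MGSHA.cond (CFC.sqrt A * Z))) := by

  refine ⟨fun m n A Z u τ σ c hA hu hτ hσ hc h i j hij =>
    hc.abs_r_sub_le hA.1 hu hτ hσ h hij, 2000, 1000000, by norm_num, by norm_num, ?_⟩
  intro m n A Z u τ σ c hn hnm hA hZ hu hτ hσ hc hsm
  rw [MGSHA.rpow_three_halves (Nat.cast_nonneg m)] at hsm ⊢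
  have hm := hτ.pos
  obtain ⟨hQ, hgram⟩ := hc.norm_gram_sub_one_le hn hnm hA hZ hu hτ hσ (by linarith)
  have hκ := MGSHA.norm_mul_invSqrtMin_sq_le hm hA
  have hρ := c.maxRatio_nonneg (A := A)
  have hl := c.maxRatio_le hm hA
  have hK := zero_le_one.trans
    (MGSHA.one_le_cond hn (MGSHA.mulVec_injective_sqrt_mul hA hZ))
  have hκ1 := MGSHA.one_le_cond hm (Matrix.mulVec_injective_iff_isUnit.mpr hA.isUnit)
  set K := MGSHA.cond (CFC.sqrt A * Z)
  set κ := MGSHA.cond A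
  set θ₁ := 2000 * ((m : ℝ) * √(m : ℝ)) * u * ‖A‖ * ‖c.Q‖ * c.maxRatio A * K with hθ₁
  set θ₂ := 1000000 * ((m : ℝ) * √(m : ℝ)) * u * κ * K with hθ₂
  have hθ₁0 : 0 ≤ θ₁ := by positivity
  -- Here $\|Q\|\le\frac32l$, $\rho\le l$ and $\|A\|l^2\le\kappa(A)$; the constant $3000$ is far
  -- below the $10^6$ that the smallness assumption requires.
  have h12 : θ₁ ≤ θ₂ := by
    have hl0 := hρ.trans hl
    calc θ₁ ≤ 2000 * ((m : ℝ) * √(m : ℝ)) * u * ‖A‖ * (3 / 2 * MGSHA.invSqrtMin A) *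
            MGSHA.invSqrtMin A * K := by
          rw [hθ₁]; gcongr
      _ = 3000 * ((m : ℝ) * √(m : ℝ)) * u * (‖A‖ * MGSHA.invSqrtMin A ^ 2) * K := by ring
      _ ≤ 1000000 * ((m : ℝ) * √(m : ℝ)) * u * κ * K := by
          gcongr
          norm_num
  have h1 : θ₁ < 1 := h12.trans_lt hsm
  refine ⟨h1, ?_, ?_⟩
  -- The bound $\theta_1$ itself is available; the denominator only weakens it.
  · rw [le_div_iff₀ (by linarith)]
    have h2 : ‖c.Qᵀ * A * c.Q - 1‖ ≤ θ₁ := by rw [hθ₁]; linarith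
    have h3 : 0 ≤ ‖c.Qᵀ * A * c.Q - 1‖ * θ₁ := by positivity
    linarith
  · rw [div_le_div_iff₀ (by linarith) (by linarith)]
    linarith
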